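/- Let $d\ge 1$ and $s\ge 0$. For $f\in L_2(\mathbb R^d)$ real-valued put $$\|f\|_{W^s_2}=\Big\{(2\pi)^{-d}\int_{\mathbb R^d}(1+|\xi|^2)^s|\hat f(\xi)|^2\,d\xi\Big\}^{1/2},\qquad \hat f(\xi)=\int_{\mathbb R^d} e^{i\xi\cdot x}f(x)\,dx$$ (the transform being defined by $L_2$ limits), and let $W^s_2=W^s_2(\mathbb R^d)$ be the space of those $f$ with $\|f\|_{W^s_2}<\infty$. Let $\Omega$ be the set of pairs $\omega=(\chi,\Lambda)$ with $\chi\in\mathbb R^d$ and $\Lambda$ a nonsingular real $d\times d$ matrix, let $G\in W^s_2$, and put $\phi(x,\omega)=G(\Lambda'(x-\chi))$, where $\Lambda'$ is the transpose of $\Lambda$. Write $|\Lambda|$ for the absolute value of the determinant of $\Lambda$ and $\rho(\Lambda)$ for its largest singular value (for positive definite $\Lambda$ this is the spectral radius, i.e. the largest eigenvalue). Let $\nu$ be a Lévy measure on $\mathbb R\times\Omega$, i.e. a Borel measure with $\nu(\{0\}\times\Omega)=0$ and $\iint_{\mathbb R\times\Omega}(1\wedge\beta^2)\,\nu(d\beta\,d\omega)<\infty$,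 and assume $$\iint_{\mathbb R\times\Omega}|\Lambda|^{-1}\,[1+\rho(\Lambda)^{2s}]\,(1\wedge\beta^2)\,\nu(d\beta\,d\omega)<\infty .$$ Let $h:\mathbb R\to\mathbb R$ be a bounded measurable compensator function with $h(\beta)=\beta+O(\beta^2)$ as $\beta\to0$. Let $N$ be a Poisson random measure on $\mathbb R\times\Omega$ with intensity $\nu$ on a probability space, and let $\tilde N=N-\nu$ be the compensated measure, whose integral is the $L_2(\nu)$-isometric one. Then the random field $$f(x)=\iint_{\mathbb R\times\Omega}\phi(x,\omega)[\beta-h(\beta)]\,N(d\beta\,d\omega)+\iint_{\mathbb R\times\Omega}\phi(x,\omega)h(\beta)\,\tilde N(d\beta\,d\omega)$$ is well defined for almost every $x\in\mathbb R^d$ and has a jointly measurable version. For $\varepsilon>0$ define $$f_\varepsilon(x)=\iint_{\{|\beta|>\varepsilon\}\times\Omega}\phi(x,\omega)\,\beta\,N(d\beta\,d\omega)-\iint_{\{|\beta|>\varepsilon\}\times\Omega}\phi(x,\omega)h(\beta)\,\nu(d\beta\,d\omega),$$ where the first integral is a sum over the almost surely finitely many points of $N$ with $|\beta|>\varepsilon$.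 Then for every jointly measurable version of $f$, almost surely: $f_\varepsilon\in W^s_2$ for every $\varepsilon>0$, $f\in W^s_2$, and $\|f_\varepsilon-f\|_{W^s_2}\to0$ as $\varepsilon\to0$. -/

import Mathlib

open MeasureTheory ProbabilityTheory Filter Topology Asymptotics FourierTransform
open scoped ENNReal NNReal

namespace LevyField

/-! ## The Sobolev norm -/

/-- The Fourier transform `∫ exp (i ξ·x) F x dx` on `L²(ℝᵈ; ℂ)`, defined by `L²` limits; it is the
`L²` Fourier transform of Mathlib (with kernel `exp (-2πi ξ·x)`) evaluated at `-ξ / (2π)`. -/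
noncomputable def fourierL2 {d : ℕ} (F : Lp (α := EuclideanSpace ℝ (Fin d)) ℂ 2 volume)
    (ξ : EuclideanSpace ℝ (Fin d)) : ℂ :=
  (𝓕 F : Lp (α := EuclideanSpace ℝ (Fin d)) ℂ 2 volume) (-(2 * Real.pi)⁻¹ • ξ)

open Classical in
/-- The norm `((2π)⁻ᵈ ∫ (1 + |ξ|²)^s |f̂(ξ)|² dξ)^(1/2)` of a real function `f`, with values in
`[0, ∞]`; it is `∞` when `f` is not in `L²`. -/
noncomputable def sobolevNorm {d : ℕ} (s : ℝ) (f : EuclideanSpace ℝ (Fin d) → ℝ) : ℝ≥0∞ :=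
  if hf : MemLp (fun x => (f x : ℂ)) 2 volume then
    (ENNReal.ofReal (((2 * Real.pi) ^ d)⁻¹) *
      ∫⁻ ξ, ENNReal.ofReal ((1 + ‖ξ‖ ^ 2) ^ s * ‖fourierL2 (hf.toLp _) ξ‖ ^ 2)) ^ (1 / 2 : ℝ)
  else ∞

/-- Membership in the Sobolev space `W^s_2(ℝᵈ)` of real functions. -/
def MemW {d : ℕ} (s : ℝ) (f : EuclideanSpace ℝ (Fin d) → ℝ) : Prop :=
  sobolevNorm s f < ∞

/-! ## Location-scale families -/

/-- Nonsingular `d × d` real matrices. -/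
abbrev Scale (d : ℕ) : Type := {L : Matrix (Fin d) (Fin d) ℝ // L.det ≠ 0}

/-- The Borel σ-algebra of the space of nonsingular matrices, generated by the entries. -/
instance instMeasurableSpaceScale (d : ℕ) : MeasurableSpace (Scale d) :=
  MeasurableSpace.comap (fun L : Scale d => fun i j : Fin d => L.1 i j) MeasurableSpace.pi

/-- The space of `ω = (χ, Λ)`, a location and a nonsingular scale matrix. -/
abbrev Param (d : ℕ) : Type := EuclideanSpace ℝ (Fin d) × Scale d

/-- The kernel `φ(x, (χ, Λ)) = G (Λ' (x - χ))`, with `Λ'` the transpose of `Λ`. -/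
noncomputable def kernel {d : ℕ} (G : EuclideanSpace ℝ (Fin d) → ℝ)
    (x : EuclideanSpace ℝ (Fin d)) (ω : Param d) : ℝ :=
  G (Matrix.toEuclideanCLM (𝕜 := ℝ) ω.2.1.transpose (x - ω.1))

/-- The largest singular value of a matrix, that is, its Euclidean operator norm. -/
noncomputable def rho {d : ℕ} (L : Matrix (Fin d) (Fin d) ℝ) : ℝ :=
  ‖Matrix.toEuclideanCLM (𝕜 := ℝ) L‖

open scoped Matrix.Norms.L2Operator in
/-- For a positive definite matrix `rho` is the spectral radius: the largest eigenvalue. -/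
theorem rho_eq_of_posDef {d : ℕ} {L : Matrix (Fin d) (Fin d) ℝ} (hL : L.PosDef) :
    rho L = ⨆ i, hL.isHermitian.eigenvalues i := by
  have h1 : rho L = ‖L‖ := rfl
  have h2 : ‖L‖ = ‖hL.isHermitian.eigenvalues‖ := by
    conv_lhs => rw [hL.isHermitian.spectral_theorem]
    rw [Unitary.conjStarAlgAut_apply, ← Unitary.coe_star, CStarRing.norm_mul_coe_unitary,
      CStarRing.norm_coe_unitary_mul, Matrix.l2_opNorm_diagonal]
    rfl
  have h3 : ∀ i, ‖hL.isHermitian.eigenvalues i‖ = hL.isHermitian.eigenvalues i := fun i =>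
    Real.norm_of_nonneg (hL.eigenvalues_pos i).le
  rw [h1, h2]
  apply le_antisymm
  · refine (pi_norm_le_iff_of_nonneg (Real.iSup_nonneg fun i => (hL.eigenvalues_pos i).le)).2 ?_
    intro i
    rw [h3]
    exact le_ciSup (Set.finite_range _).bddAbove i
  · refine Real.iSup_le (fun i => ?_) (norm_nonneg _)
    rw [← h3]
    exact norm_le_pi_norm _ i

/-! ## Compensators, Poisson random measures and their integrals -/

/-- Bounded measurable functions `h` with `h β = β + O(β²)` as `β → 0`. -/
structure IsCompensator (h : ℝ → ℝ) : Prop where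
  measurable : Measurable h
  bounded : ∃ M : ℝ, ∀ β, |h β| ≤ M
  isBigO : (fun β => h β - β) =O[𝓝 0] (fun β => β ^ 2)

/-- `N` is a Poisson random measure with intensity measure `ν` on the probability space `(S, P)`:
`N(C)` is Poisson with mean `ν(C)` when that is finite, and the values on disjoint sets are
independent. -/
structure IsPoissonRandomMeasure {S X : Type*} [MeasurableSpace S] [MeasurableSpace X]
    (P : Measure S) (ν : Measure X) (N : S → Measure X) : Prop where
  measurable : Measurable N
  map_eq : ∀ C : Set X, MeasurableSet C → ν C ≠ ∞ →
    P.map (fun θ => N θ C) = (poissonMeasure (ν C).toNNReal).map (fun n : ℕ => (n : ℝ≥0∞))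
  indep : ∀ (n : ℕ) (C : Fin n → Set X), (∀ i, MeasurableSet (C i)) →
    Pairwise (Function.onFun Disjoint C) → iIndepFun (fun i θ => N θ (C i)) P

/-- `Z` is a version of the integral `∫ ψ dÑ` of `ψ ∈ L²(ν)` with respect to the compensated
measure `Ñ = N - ν`: the `L²(P)` limit of `∫ ψₙ dN - ∫ ψₙ dν` for `ψₙ ∈ L¹(ν) ∩ L²(ν)` with
`ψₙ → ψ` in `L²(ν)`. -/
def IsCompensatedIntegral {S X : Type*} [MeasurableSpace S] [MeasurableSpace X]
    (P : Measure S) (ν : Measure X) (N : S → Measure X) (ψ : X → ℝ) (Z : S → ℝ) : Prop :=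
  MemLp ψ 2 ν ∧ MemLp Z 2 P ∧ ∃ ψn : ℕ → X → ℝ,
    (∀ n, Integrable (ψn n) ν ∧ MemLp (ψn n) 2 ν) ∧
    Tendsto (fun n => eLpNorm (fun p => ψn n p - ψ p) 2 ν) atTop (𝓝 0) ∧
    Tendsto (fun n => eLpNorm
      (fun θ => (∫ p, ψn n p ∂(N θ)) - (∫ p, ψn n p ∂ν) - Z θ) 2 P) atTop (𝓝 0)

/-- `f` is a jointly measurable version of the random field
`f(x) = ∬ φ(x,ω) [β - h(β)] N(dβ dω) + ∬ φ(x,ω) h(β) Ñ(dβ dω)`, both integrals being well defined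
for almost every `x`. -/
structure IsLevyField {S : Type*} [MeasurableSpace S] {d : ℕ} (P : Measure S)
    (ν : Measure (ℝ × Param d)) (N : S → Measure (ℝ × Param d)) (h : ℝ → ℝ)
    (G : EuclideanSpace ℝ (Fin d) → ℝ) (f : S → EuclideanSpace ℝ (Fin d) → ℝ) : Prop where
  measurable : Measurable (Function.uncurry f)
  eq_integral : ∀ᵐ x, ∃ Z : S → ℝ,
    IsCompensatedIntegral P ν N (fun p => kernel G x p.2 * h p.1) Z ∧
    ∀ᵐ θ ∂P, Integrable (fun p => kernel G x p.2 * (p.1 - h p.1)) (N θ) ∧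
      f θ x = (∫ p, kernel G x p.2 * (p.1 - h p.1) ∂(N θ)) + Z θ

/-- The set of points `(β, ω)` with `|β| > ε`. -/
def jumps (d : ℕ) (ε : ℝ) : Set (ℝ × Param d) := {p | ε < |p.1|}

/-- The truncated field
`f_ε(x) = ∬_{|β| > ε} φ(x,ω) β N(dβ dω) - ∬_{|β| > ε} φ(x,ω) h(β) ν(dβ dω)`; the first integral is
the sum of `φ(x,ω_j) β_j` over the finitely many points of `N` with `|β_j| > ε`. -/
noncomputable def truncField {S : Type*} {d : ℕ}
    (ν : Measure (ℝ × Param d)) (N : S → Measure (ℝ × Param d)) (h : ℝ → ℝ)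
    (G : EuclideanSpace ℝ (Fin d) → ℝ) (ε : ℝ) (θ : S) (x : EuclideanSpace ℝ (Fin d)) : ℝ :=
  (∫ p in jumps d ε, kernel G x p.2 * p.1 ∂(N θ)) - ∫ p in jumps d ε, kernel G x p.2 * h p.1 ∂ν

end LevyField

/-! The proof turns the statement into the almost sure convergence of a random integral in a Hilbert
space. Let `H` be `L²` in the frequency variable. The map `sobolevEmb`, which divides by the Sobolev
weight and inverts the Fourier transform, carries `H` isometrically into functions measured by the
Sobolev norm. Each `φ(·, ω)` is the image of some `k ω` in `H`, and a change of variables in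
frequency gives `‖k ω‖² ≤ C |Λ|⁻¹ (1 + ρ(Λ)^(2s))`. The integrability assumption therefore says that
`‖k‖² (1 ∧ β²)` is `ν`-integrable (`exists_kernel_hilbert`, `lintegral_kernel_hilbert_ne_top`).

In `H` the truncated field is `∫ (β - h) k dN` over `|β| > ε` plus the compensated integral of `h k`
over the same set. The first integrand is almost surely `N`-integrable: small jumps satisfy `|β - h|
≤ C (1 ∧ β²)` and `‖k‖ ≤ 1 + ‖k‖²`, and there are only finitely many large jumps. Dominated
convergence handles this part. The second integrand is in `L²(ν)`, since `h² ≤ C (1 ∧ β²)`. The `L²`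
bound (`eLpNorm_compensated_le`), the independence of `N` on disjoint sets (`indepFun_restrict`) and
Ottaviani's inequality (`measure_exists_lt_norm_compInt_le`) control its oscillation over rational
levels. Right continuity in `ε` extends this to all levels, giving almost sure convergence in `H`
(`ae_exists_tendsto_truncInt`).

It remains to identify the limit with `f`. The same theorem in the Hilbert space `ℝ`, with `φ(x, ·)`
in place of `k`, shows that at almost every `x` the truncated fields at levels `1 / (n + 1)`
converge almost surely to `f(x)`. Fubini exchanges the two null sets (`IsLevyField.ae_ae_tendsto`),
and a subsequence of the `L²`-convergent fields converges almost everywhere, so the two limits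
agree. -/

namespace LevyField

/-! ### Moments of the Poisson law -/

section PoissonMoments

theorem hasSum_poisson_mean (r : ℝ≥0) :
    HasSum (fun n : ℕ => Real.exp (-r) * r ^ n / (n.factorial : ℝ) * n) r := by
  rw [← hasSum_nat_add_iff' 1]
  have h := (hasSum_one_poissonMeasure r).mul_left (r : ℝ)
  simp only [Finset.range_one, Finset.sum_singleton, Nat.cast_zero, mul_zero, sub_zero]
  rw [mul_one] at h
  refine (congrArg (fun F => HasSum F _) (funext fun n => ?_)).mpr h
  rw [Nat.factorial_succ]
  push_cast
  field_simp
  ring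

theorem hasSum_poisson_factorial_moment (r : ℝ≥0) :
    HasSum (fun n : ℕ => Real.exp (-r) * r ^ n / (n.factorial : ℝ) * (n * (n - 1))) ((r : ℝ) ^ 2) := by
  rw [← hasSum_nat_add_iff' 2]
  have h := (hasSum_one_poissonMeasure r).mul_left ((r : ℝ) ^ 2)
  simp only [Finset.sum_range_succ, Finset.range_zero, Finset.sum_empty, Nat.cast_zero, zero_mul,
    mul_zero, Nat.cast_one, sub_self, add_zero, sub_zero]
  rw [mul_one] at h
  refine (congrArg (fun F => HasSum F _) (funext fun n => ?_)).mpr h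
  rw [Nat.factorial_succ, Nat.factorial_succ]
  push_cast
  field_simp
  ring

/-- Follows from `(n - r)² = n (n - 1) + (1 - 2 r) n + r²` and the factorial moments. -/
theorem hasSum_poisson_variance (r : ℝ≥0) :
    HasSum (fun n : ℕ => Real.exp (-r) * r ^ n / (n.factorial : ℝ) * (n - r) ^ 2) (r : ℝ) := by
  have h := ((hasSum_poisson_factorial_moment r).add
    ((hasSum_poisson_mean r).mul_left (1 - 2 * (r : ℝ)))).add
    ((hasSum_one_poissonMeasure r).mul_left ((r : ℝ) ^ 2))
  convert h using 1
  · ext n; ring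
  · ring

theorem integrable_natCast_poissonMeasure (r : ℝ≥0) :
    Integrable (fun n : ℕ => (n : ℝ)) (poissonMeasure r) := by
  rw [integrable_poissonMeasure_iff]
  simpa using (hasSum_poisson_mean r).summable

theorem integral_natCast_poissonMeasure (r : ℝ≥0) :
    ∫ n : ℕ, (n : ℝ) ∂(poissonMeasure r) = r := by
  rw [integral_poissonMeasure]
  simpa using (hasSum_poisson_mean r).tsum_eq

theorem integrable_sq_sub_poissonMeasure (r : ℝ≥0) :
    Integrable (fun n : ℕ => ((n : ℝ) - r) ^ 2) (poissonMeasure r) := by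
  rw [integrable_poissonMeasure_iff]
  simpa using (hasSum_poisson_variance r).summable

theorem integral_sq_sub_poissonMeasure (r : ℝ≥0) :
    ∫ n : ℕ, ((n : ℝ) - r) ^ 2 ∂(poissonMeasure r) = r := by
  rw [integral_poissonMeasure]
  simpa using (hasSum_poisson_variance r).tsum_eq

end PoissonMoments

/-! ### Moments of the counts and Campbell's formula -/

namespace IsPoissonRandomMeasure

variable {S X : Type*} [MeasurableSpace S] [MeasurableSpace X]
  {P : Measure S} {ν : Measure X} {N : S → Measure X}

theorem real_eq (C : Set X) : ν.real C = ((ν C).toNNReal : ℝ) := rfl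

theorem measurable_apply (hN : IsPoissonRandomMeasure P ν N) {C : Set X} (hC : MeasurableSet C) :
    Measurable fun θ => N θ C :=
  (Measure.measurable_coe hC).comp hN.measurable

theorem measurable_real (hN : IsPoissonRandomMeasure P ν N) {C : Set X} (hC : MeasurableSet C) :
    Measurable fun θ => (N θ).real C :=
  (hN.measurable_apply hC).ennreal_toReal

theorem integral_comp_apply (hN : IsPoissonRandomMeasure P ν N) {C : Set X} (hC : MeasurableSet C)
    (hνC : ν C ≠ ∞) {F : ℝ≥0∞ → ℝ} (hF : Measurable F) :
    ∫ θ, F (N θ C) ∂P = ∫ n : ℕ, F n ∂(poissonMeasure (ν C).toNNReal) := by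
  rw [← integral_map (hN.measurable_apply hC).aemeasurable hF.aestronglyMeasurable,
    hN.map_eq C hC hνC, integral_map (by fun_prop) hF.aestronglyMeasurable]

theorem integrable_comp_apply (hN : IsPoissonRandomMeasure P ν N) {C : Set X}
    (hC : MeasurableSet C) (hνC : ν C ≠ ∞) {F : ℝ≥0∞ → ℝ} (hF : Measurable F) :
    Integrable (fun θ => F (N θ C)) P ↔
      Integrable (fun n : ℕ => F n) (poissonMeasure (ν C).toNNReal) := by
  have h := integrable_map_measure (μ := P) (f := fun θ => N θ C)
    (hF.aestronglyMeasurable) (hN.measurable_apply hC).aemeasurable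
  rw [hN.map_eq C hC hνC, integrable_map_measure hF.aestronglyMeasurable (by fun_prop)] at h
  exact h.symm

theorem lintegral_apply (hN : IsPoissonRandomMeasure P ν N) {C : Set X}
    (hC : MeasurableSet C) (hνC : ν C ≠ ∞) : ∫⁻ θ, N θ C ∂P = ν C := by
  have h1 : ∫⁻ θ, N θ C ∂P = ∫⁻ n : ℕ, (n : ℝ≥0∞) ∂(poissonMeasure (ν C).toNNReal) := by
    rw [← lintegral_map (f := fun x : ℝ≥0∞ => x) measurable_id (hN.measurable_apply hC),
      hN.map_eq C hC hνC]
    erw [lintegral_map measurable_id (by fun_prop : Measurable fun n : ℕ => (n : ℝ≥0∞))]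
    rfl
  have h2 := ofReal_integral_eq_lintegral_ofReal
    (integrable_natCast_poissonMeasure (ν C).toNNReal) (ae_of_all _ fun n => Nat.cast_nonneg n)
  rw [integral_natCast_poissonMeasure] at h2
  simp only [ENNReal.ofReal_natCast] at h2
  rw [h1, ← h2, ENNReal.ofReal_coe_nnreal, ENNReal.coe_toNNReal hνC]

theorem integrable_sq_sub (hN : IsPoissonRandomMeasure P ν N) {C : Set X}
    (hC : MeasurableSet C) (hνC : ν C ≠ ∞) :
    Integrable (fun θ => ((N θ).real C - ν.real C) ^ 2) P :=
  (hN.integrable_comp_apply hC hνC (F := fun x => (x.toReal - ν.real C) ^ 2) (by fun_prop)).2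
    (by simpa [real_eq] using integrable_sq_sub_poissonMeasure (ν C).toNNReal)

theorem integral_sq_sub (hN : IsPoissonRandomMeasure P ν N) {C : Set X}
    (hC : MeasurableSet C) (hνC : ν C ≠ ∞) :
    ∫ θ, ((N θ).real C - ν.real C) ^ 2 ∂P = ν.real C := by
  have := hN.integral_comp_apply hC hνC (F := fun x => (x.toReal - ν.real C) ^ 2) (by fun_prop)
  rw [show (∫ θ, ((N θ).real C - ν.real C) ^ 2 ∂P) = _ from this]
  simpa [real_eq] using integral_sq_sub_poissonMeasure (ν C).toNNReal

theorem integral_real (hN : IsPoissonRandomMeasure P ν N) {C : Set X}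
    (hC : MeasurableSet C) (hνC : ν C ≠ ∞) :
    ∫ θ, (N θ).real C ∂P = ν.real C := by
  have := hN.integral_comp_apply hC hνC (F := fun x => x.toReal) (by fun_prop)
  rw [show (∫ θ, (N θ).real C ∂P) = _ from this]
  simpa [real_eq] using integral_natCast_poissonMeasure (ν C).toNNReal

theorem integrable_real (hN : IsPoissonRandomMeasure P ν N) {C : Set X}
    (hC : MeasurableSet C) (hνC : ν C ≠ ∞) : Integrable (fun θ => (N θ).real C) P :=
  (hN.integrable_comp_apply hC hνC (F := fun x => x.toReal) (by fun_prop)).2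
    (by simpa using integrable_natCast_poissonMeasure (ν C).toNNReal)

theorem memLp_sub [IsProbabilityMeasure P] (hN : IsPoissonRandomMeasure P ν N) {C : Set X}
    (hC : MeasurableSet C) (hνC : ν C ≠ ∞) :
    MemLp (fun θ => (N θ).real C - ν.real C) 2 P :=
  (memLp_two_iff_integrable_sq
    ((hN.measurable_real hC).sub_const _).aestronglyMeasurable).2 (hN.integrable_sq_sub hC hνC)

theorem indepFun_apply (hN : IsPoissonRandomMeasure P ν N) {C D : Set X} (hC : MeasurableSet C)
    (hD : MeasurableSet D) (hCD : Disjoint C D) :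
    IndepFun (fun θ => N θ C) (fun θ => N θ D) P := by
  have h := hN.indep 2 ![C, D] (by intro i; fin_cases i <;> simpa)
    (by
      intro i j hij
      fin_cases i <;> fin_cases j <;> simp_all [Function.onFun, disjoint_comm])
  simpa using h.indepFun (i := 0) (j := 1) (by simp)

theorem integral_sub_mul_sub [IsProbabilityMeasure P] (hN : IsPoissonRandomMeasure P ν N)
    {C D : Set X} (hC : MeasurableSet C)
    (hD : MeasurableSet D) (hCD : Disjoint C D) (hνC : ν C ≠ ∞) :
    ∫ θ, ((N θ).real C - ν.real C) * ((N θ).real D - ν.real D) ∂P = 0 := by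
  have h := (hN.indepFun_apply hC hD hCD).comp
    (φ := fun x => x.toReal - ν.real C) (ψ := fun x => x.toReal - ν.real D)
    (by fun_prop) (by fun_prop)
  have h2 := h.integral_fun_mul_eq_mul_integral
    ((hN.measurable_real hC).sub_const _).aestronglyMeasurable
    ((hN.measurable_real hD).sub_const _).aestronglyMeasurable
  refine (h2 : ∫ θ, ((N θ).real C - ν.real C) * ((N θ).real D - ν.real D) ∂P = _).trans ?_
  have h3 : ∫ θ, ((N θ).real C - ν.real C) ∂P = 0 := by
    rw [integral_sub (hN.integrable_real hC hνC) (integrable_const _), hN.integral_real hC hνC]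
    simp
  exact mul_eq_zero_of_left h3 _

/-- The law of a count is prescribed only for sets of finite intensity; σ-finiteness exhausts every
other set by such sets. Campbell's formula and the transfer of `ν`-null sets to almost every `N θ`
both come from this identity. -/
theorem bind_eq [SigmaFinite ν] (hN : IsPoissonRandomMeasure P ν N) : P.bind N = ν := by
  ext C hC
  rw [Measure.bind_apply hC hN.measurable.aemeasurable]
  have hm : Monotone fun n => C ∩ spanningSets ν n := fun i j hij =>
    Set.inter_subset_inter_right _ (monotone_spanningSets ν hij)
  have hU : ⋃ n, C ∩ spanningSets ν n = C := by
    rw [← Set.inter_iUnion, iUnion_spanningSets, Set.inter_univ]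
  have hmeas : ∀ n, MeasurableSet (C ∩ spanningSets ν n) := fun n =>
    hC.inter (measurableSet_spanningSets ν n)
  have h1 : ∀ m : Measure X, m C = ⨆ n, m (C ∩ spanningSets ν n) := fun m => by
    rw [← hm.measure_iUnion, hU]
  simp_rw [h1]
  rw [lintegral_iSup (fun n => hN.measurable_apply (hmeas n))
    (fun i j hij θ => measure_mono (hm hij))]
  congr 1 with n
  exact hN.lintegral_apply (hmeas n)
    ((measure_mono Set.inter_subset_right).trans_lt (measure_spanningSets_lt_top ν n)).ne

theorem lintegral_lintegral [SigmaFinite ν] (hN : IsPoissonRandomMeasure P ν N) {g : X → ℝ≥0∞}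
    (hg : Measurable g) : ∫⁻ θ, ∫⁻ p, g p ∂(N θ) ∂P = ∫⁻ p, g p ∂ν := by
  conv_rhs => rw [← hN.bind_eq, Measure.lintegral_bind hN.measurable.aemeasurable hg.aemeasurable]

theorem ae_ae [SigmaFinite ν] (hN : IsPoissonRandomMeasure P ν N) {q : X → Prop}
    (hq : ∀ᵐ p ∂ν, q p) : ∀ᵐ θ ∂P, ∀ᵐ p ∂(N θ), q p := by
  rw [← hN.bind_eq] at hq
  exact Measure.ae_ae_of_ae_bind hN.measurable.aemeasurable hq

theorem ae_lintegral_lt_top [SigmaFinite ν] (hN : IsPoissonRandomMeasure P ν N) {g : X → ℝ≥0∞}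
    (hg : Measurable g) (h : ∫⁻ p, g p ∂ν ≠ ∞) : ∀ᵐ θ ∂P, ∫⁻ p, g p ∂(N θ) < ∞ := by
  refine ae_lt_top ((Measure.measurable_lintegral hg).comp hN.measurable) ?_
  rwa [hN.lintegral_lintegral hg]

theorem ae_integrable [SigmaFinite ν] (hN : IsPoissonRandomMeasure P ν N)
    {E : Type*} [NormedAddCommGroup E] {g : X → E}
    (hg : Integrable g ν) : ∀ᵐ θ ∂P, Integrable g (N θ) := by
  have h1 := hN.ae_ae hg.1.ae_eq_mk
  have h2 := hN.ae_lintegral_lt_top hg.1.stronglyMeasurable_mk.enorm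
    (((lintegral_congr_ae (hg.1.ae_eq_mk.mono fun p hp => by simp [hp])).symm.trans_lt hg.2).ne)
  filter_upwards [h1, h2] with θ h1 h2
  exact (show Integrable (hg.1.mk g) (N θ) from
    ⟨hg.1.stronglyMeasurable_mk.aestronglyMeasurable, h2⟩).congr (h1.mono fun p hp => hp.symm)

end IsPoissonRandomMeasure


theorem eLpNorm_two_eq_lintegral {Y E : Type*} [MeasurableSpace Y] [NormedAddCommGroup E] (f : Y → E)
    (μ : Measure Y) : eLpNorm f 2 μ = (∫⁻ y, ‖f y‖ₑ ^ 2 ∂μ) ^ (1 / 2 : ℝ) := by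
  rw [eLpNorm_eq_lintegral_rpow_enorm_toReal (by simp) (by simp)]
  simp

/-! ### Measurability of the Bochner integral in the measure -/

section MeasureIntegral

variable {X E : Type*} [MeasurableSpace X] [NormedAddCommGroup E]

theorem _root_.MeasureTheory.SimpleFunc.stronglyMeasurable_integral [NormedSpace ℝ E]
    (f : SimpleFunc X E) : StronglyMeasurable fun m : Measure X => f.integral m := by
  classical
  simp_rw [SimpleFunc.integral_eq_sum_filter]
  refine Finset.stronglyMeasurable_fun_sum _ fun x _ => ?_
  exact ((Measure.measurable_coe
    (f.measurableSet_fiber x)).ennreal_toReal.stronglyMeasurable).smul_const x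

/-- The Bochner integral of a fixed function is a measurable function of the measure. -/
theorem stronglyMeasurable_integral_measure [NormedSpace ℝ E] [CompleteSpace E] {g : X → E}
    (hg : StronglyMeasurable g) : StronglyMeasurable fun m : Measure X => ∫ p, g p ∂m := by
  have hfin : MeasurableSet {m : Measure X | ∫⁻ p, ‖g p‖ₑ ∂m < ∞} :=
    Measure.measurable_lintegral hg.enorm measurableSet_Iio
  borelize E
  have := hg.separableSpace_range_union_singleton (b := 0)
  let s := SimpleFunc.approxOn g hg.measurable (Set.range g ∪ {0}) 0 (by simp)
  -- The approximants are cut off to the measures that integrate `g`: elsewhere the Bochner integral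
  -- is `0` by default, and the integrals of the simple functions need not tend to it.
  refine stronglyMeasurable_of_tendsto atTop
    (fun n => (s n).stronglyMeasurable_integral.indicator hfin) ?_
  rw [tendsto_pi_nhds]
  intro m
  by_cases hm : ∫⁻ p, ‖g p‖ₑ ∂m < ∞
  · have hi : Integrable g m := ⟨hg.aestronglyMeasurable, hm⟩
    simp only [Set.indicator_of_mem (show m ∈ {m : Measure X | ∫⁻ p, ‖g p‖ₑ ∂m < ∞} from hm)]
    exact tendsto_integral_approxOn_of_measurable_of_range_subset hg.measurable hi _ subset_rfl
  · have hi : ¬ Integrable g m := fun h => hm h.2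
    simp only [Set.indicator_of_notMem (show m ∉ {m : Measure X | ∫⁻ p, ‖g p‖ₑ ∂m < ∞} from hm),
      integral_undef hi]
    exact tendsto_const_nhds

end MeasureIntegral

namespace IsPoissonRandomMeasure

variable {S X : Type*} [MeasurableSpace S] [MeasurableSpace X]
  {P : Measure S} {ν : Measure X} {N : S → Measure X}

theorem stronglyMeasurable_integral (hN : IsPoissonRandomMeasure P ν N)
    {E : Type*} [NormedAddCommGroup E] [NormedSpace ℝ E] [CompleteSpace E] {g : X → E}
    (hg : StronglyMeasurable g) : StronglyMeasurable fun θ => ∫ p, g p ∂(N θ) :=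
  (stronglyMeasurable_integral_measure hg).comp_measurable hN.measurable

/-! ### The `L²` bound for compensated integrals -/

section Isometry

variable [IsProbabilityMeasure P]
  {H : Type*} [NormedAddCommGroup H] [InnerProductSpace ℝ H]

/-- Fibres over distinct values are disjoint, so their centred counts are independent and the cross
terms vanish. The diagonal terms are Poisson variances, equal to the intensities of the fibres. -/
theorem lintegral_enorm_sq_simpleFunc (hN : IsPoissonRandomMeasure P ν N) (f : SimpleFunc X H)
    (hf : Integrable f ν) :
    ∫⁻ θ, ‖f.integral (N θ) - f.integral ν‖ₑ ^ 2 ∂P = ∫⁻ p, ‖f p‖ₑ ^ 2 ∂ν := by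
  classical
  -- The value `0` is dropped because its fibre may have infinite intensity.
  set R := f.range.filter (· ≠ 0) with hR
  have hm : ∀ x, MeasurableSet (f ⁻¹' {x}) := f.measurableSet_fiber
  have hfin : ∀ x ∈ R, ν (f ⁻¹' {x}) ≠ ∞ := fun x hx =>
    ((SimpleFunc.integrable_iff.1 hf) x (Finset.mem_filter.1 hx).2).ne
  set Y : H → S → ℝ := fun x θ => (N θ).real (f ⁻¹' {x}) - ν.real (f ⁻¹' {x}) with hY
  have hYL : ∀ x ∈ R, MemLp (Y x) 2 P := fun x hx => hN.memLp_sub (hm x) (hfin x hx)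
  have hV : ∀ θ, f.integral (N θ) - f.integral ν = ∑ x ∈ R, Y x θ • x := by
    intro θ
    rw [SimpleFunc.integral_eq_sum_filter, SimpleFunc.integral_eq_sum_filter,
      ← Finset.sum_sub_distrib]
    exact Finset.sum_congr rfl fun x _ => (sub_smul _ _ _).symm
  have hVL : MemLp (fun θ => ∑ x ∈ R, Y x θ • x) 2 P :=
    memLp_finsetSum _ fun x hx => (ContinuousLinearMap.toSpanSingleton ℝ x).comp_memLp' (hYL x hx)
  have hint : ∫ θ, ‖∑ x ∈ R, Y x θ • x‖ ^ 2 ∂P = ∑ x ∈ R, ‖x‖ ^ 2 * ν.real (f ⁻¹' {x}) := by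
    have h1 : ∀ θ, ‖∑ x ∈ R, Y x θ • x‖ ^ 2 =
        ∑ x ∈ R, ∑ y ∈ R, (Y x θ * Y y θ) * inner ℝ x y := by
      intro θ
      rw [← real_inner_self_eq_norm_sq, sum_inner]
      refine Finset.sum_congr rfl fun x _ => ?_
      rw [inner_sum]
      refine Finset.sum_congr rfl fun y _ => ?_
      rw [real_inner_smul_left, real_inner_smul_right]
      ring
    have hi : ∀ x ∈ R, ∀ y ∈ R, Integrable (fun θ => (Y x θ * Y y θ) * inner ℝ x y) P :=
      fun x hx y hy => ((hYL x hx).integrable_mul (hYL y hy)).mul_const _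
    simp_rw [h1]
    rw [integral_finsetSum _ fun x hx => integrable_finsetSum _ fun y hy => hi x hx y hy]
    refine Finset.sum_congr rfl fun x hx => ?_
    rw [integral_finsetSum _ fun y hy => hi x hx y hy, Finset.sum_eq_single_of_mem x hx]
    · rw [integral_mul_const, real_inner_self_eq_norm_sq, mul_comm]
      congr 1
      simp_rw [← pow_two]
      exact hN.integral_sq_sub (hm x) (hfin x hx)
    · intro y hy hyx
      rw [integral_mul_const]
      have hd : Disjoint (f ⁻¹' {x}) (f ⁻¹' {y}) := by
        refine Disjoint.preimage _ ?_
        simpa using fun h => hyx h.symm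
      rw [show (∫ θ, Y x θ * Y y θ ∂P) = 0 from
        hN.integral_sub_mul_sub (hm x) (hm y) hd (hfin x hx), zero_mul]
  have hl : ∫⁻ θ, ‖f.integral (N θ) - f.integral ν‖ₑ ^ 2 ∂P =
      ENNReal.ofReal (∫ θ, ‖∑ x ∈ R, Y x θ • x‖ ^ 2 ∂P) := by
    rw [ofReal_integral_eq_lintegral_ofReal hVL.norm.integrable_sq
      (ae_of_all _ fun θ => by positivity)]
    refine lintegral_congr fun θ => ?_
    rw [hV, ENNReal.ofReal_pow (norm_nonneg _), ofReal_norm]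
  have hr : ∫⁻ p, ‖f p‖ₑ ^ 2 ∂ν = ∑ x ∈ R, ‖x‖ₑ ^ 2 * ν (f ⁻¹' {x}) := by
    have : ∫⁻ p, ‖f p‖ₑ ^ 2 ∂ν = (f.map fun x => ‖x‖ₑ ^ 2).lintegral ν := by
      rw [← SimpleFunc.lintegral_eq_lintegral]
      rfl
    rw [this, SimpleFunc.map_lintegral, hR, Finset.sum_filter]
    refine Finset.sum_congr rfl fun x _ => ?_
    split_ifs with h
    · rfl
    · simp [not_not.1 h]
  rw [hl, hr, hint, ENNReal.ofReal_sum_of_nonneg fun x _ => by positivity]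
  refine Finset.sum_congr rfl fun x hx => ?_
  rw [ENNReal.ofReal_mul (by positivity), ENNReal.ofReal_pow (norm_nonneg _), ofReal_norm,
    ofReal_measureReal (hfin x hx)]

/-- The `L²` bound for integrals against the compensated random measure. -/
theorem eLpNorm_compensated_le [SigmaFinite ν] [CompleteSpace H]
    (hN : IsPoissonRandomMeasure P ν N) {g : X → H}
    (h1 : Integrable g ν) (h2 : MemLp g 2 ν) :
    eLpNorm (fun θ => (∫ p, g p ∂(N θ)) - ∫ p, g p ∂ν) 2 P ≤ eLpNorm g 2 ν := by
  wlog hg : StronglyMeasurable g generalizing g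
  · have hae := h1.1.ae_eq_mk
    have := this (h1.congr hae) (h2.ae_eq hae) h1.1.stronglyMeasurable_mk
    rw [eLpNorm_congr_ae hae]
    refine le_trans (eLpNorm_congr_ae ?_).le this
    filter_upwards [hN.ae_ae hae] with θ hθ
    rw [integral_congr_ae hθ, integral_congr_ae hae]
  borelize H
  have := hg.separableSpace_range_union_singleton (b := 0)
  let s := SimpleFunc.approxOn g hg.measurable (Set.range g ∪ {0}) 0 (by simp)
  have hsi : ∀ n, Integrable (s n) ν := SimpleFunc.integrable_approxOn_range hg.measurable h1
  have hlim : ∀ m : Measure X, Integrable g m →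
      Tendsto (fun n => (s n).integral m) atTop (𝓝 (∫ p, g p ∂m)) := fun m hm =>
    tendsto_integral_approxOn_of_measurable_of_range_subset hg.measurable hm _ subset_rfl
  have hL2 := SimpleFunc.tendsto_approxOn_range_Lp_eLpNorm (p := 2) (by simp) hg.measurable h2.2
  have hmeas : ∀ n, StronglyMeasurable fun θ => (s n).integral (N θ) - (s n).integral ν :=
    fun n => ((s n).stronglyMeasurable_integral.comp_measurable hN.measurable).sub
      stronglyMeasurable_const
  -- The integrals of the simple functions converge almost surely, because `g` is `N θ`-integrable
  -- for almost every `θ`; Fatou then passes their isometry to an inequality for `g`.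
  have hfatou := Lp.eLpNorm_lim_le_liminf_eLpNorm (p := 2) (μ := P)
    (fun n => (hmeas n).aestronglyMeasurable)
    (fun θ => (∫ p, g p ∂(N θ)) - ∫ p, g p ∂ν) (by
      filter_upwards [hN.ae_integrable h1] with θ hθ
      exact (hlim _ hθ).sub (hlim _ h1))
  refine hfatou.trans ?_
  have hub : Tendsto (fun n => eLpNorm (⇑(s n) - g) 2 ν + eLpNorm g 2 ν) atTop
      (𝓝 (0 + eLpNorm g 2 ν)) := hL2.add tendsto_const_nhds
  rw [zero_add] at hub
  rw [← hub.liminf_eq]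
  refine liminf_le_liminf (Eventually.of_forall fun n => ?_)
  have he : eLpNorm (fun θ => (s n).integral (N θ) - (s n).integral ν) 2 P
      = eLpNorm (s n) 2 ν := by
    rw [eLpNorm_two_eq_lintegral, eLpNorm_two_eq_lintegral, hN.lintegral_enorm_sq_simpleFunc (s n) (hsi n)]
  rw [he]
  calc eLpNorm (s n) 2 ν = eLpNorm ((⇑(s n) - g) + g) 2 ν := by rw [sub_add_cancel]
    _ ≤ _ := eLpNorm_add_le ((s n).aestronglyMeasurable.sub hg.aestronglyMeasurable)
      hg.aestronglyMeasurable (by norm_num)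

end Isometry

/-! ### Independence of the restrictions to disjoint sets -/

section Independence

theorem iIndepFun_apply (hN : IsPoissonRandomMeasure P ν N) {T : Type*} [Finite T]
    (C : T → Set X) (hC : ∀ t, MeasurableSet (C t)) (hd : Pairwise (Function.onFun Disjoint C)) :
    iIndepFun (fun t θ => N θ (C t)) P := by
  have := Fintype.ofFinite T
  let e := Fintype.equivFin T
  have h := hN.indep (Fintype.card T) (fun i => C (e.symm i)) (fun i => hC _)
    (fun i j hij => hd (e.symm.injective.ne hij))
  simpa using h.precomp e.injective

/-- The atoms of the algebra of subsets of `A` generated by a finite family. -/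
def atom {I : Type*} (A : Set X) (C : I → Set X) (a : I → Prop) : Set X :=
  {p ∈ A | ∀ i, p ∈ C i ↔ a i}

theorem measurableSet_atom {I : Type*} [Finite I] {A : Set X} (hA : MeasurableSet A)
    {C : I → Set X} (hC : ∀ i, MeasurableSet (C i)) (a : I → Prop) :
    MeasurableSet (atom A C a) := by
  have : atom A C a = A ∩ ⋂ i, {p | p ∈ C i ↔ a i} := by
    ext p; simp [atom]
  rw [this]
  refine hA.inter (MeasurableSet.iInter fun i => ?_)
  exact (hC i).iff (MeasurableSet.const _)

theorem disjoint_atom {X I : Type*} (A : Set X) (C : I → Set X) {a a' : I → Prop} (h : a ≠ a') :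
    Disjoint (atom A C a) (atom A C a') := by
  rw [Set.disjoint_left]
  intro p hp hp'
  exact h (funext fun i => propext ((hp.2 i).symm.trans (hp'.2 i)))

theorem measure_inter_eq_sum_atom {I : Type*} [Finite I] {A : Set X} (hA : MeasurableSet A)
    {C : I → Set X} (hC : ∀ i, MeasurableSet (C i)) (m : Measure X) (i : I) :
    m (C i ∩ A) = ∑' a : {a : I → Prop // a i}, m (atom A C a.1) := by
  rw [← measure_iUnion (fun a a' h => disjoint_atom A C (fun h' => h (Subtype.ext h')))
    fun a => measurableSet_atom hA hC a.1]
  congr 1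
  ext p
  simp only [Set.mem_inter_iff, Set.mem_iUnion, atom, Set.mem_ofPred_eq]
  constructor
  · rintro ⟨h1, h2⟩
    exact ⟨⟨fun j => p ∈ C j, h1⟩, h2, fun j => Iff.rfl⟩
  · rintro ⟨a, h1, h2⟩
    exact ⟨(h2 i).2 a.2, h1⟩

/-- Independence is given for disjoint sets only, while the `C i` may overlap. Each count is a sum
of counts of atoms; the atoms in `A` and those in `B` form one disjoint family, split into two
groups. -/
theorem indepFun_inter_finite [IsProbabilityMeasure P] (hN : IsPoissonRandomMeasure P ν N) {A B : Set X}
    (hA : MeasurableSet A) (hB : MeasurableSet B) (hAB : Disjoint A B) {I J : Type*} [Finite I]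
    [Finite J] (C : I → Set X) (hC : ∀ i, MeasurableSet (C i)) (D : J → Set X)
    (hD : ∀ j, MeasurableSet (D j)) :
    IndepFun (fun θ i => N θ (C i ∩ A)) (fun θ j => N θ (D j ∩ B)) P := by
  classical
  let T := (I → Prop) ⊕ (J → Prop)
  have := Fintype.ofFinite T
  let K : T → Set X := Sum.elim (atom A C) (atom B D)
  have hK : ∀ t, MeasurableSet (K t) := by
    rintro (a | a)
    · exact measurableSet_atom hA hC a
    · exact measurableSet_atom hB hD a
  have hKd : Pairwise (Function.onFun Disjoint K) := by
    rintro (a | a) (a' | a') h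
    · exact disjoint_atom A C fun h' => h (congrArg _ h')
    · exact hAB.mono (fun p hp => hp.1) (fun p hp => hp.1)
    · exact hAB.symm.mono (fun p hp => hp.1) (fun p hp => hp.1)
    · exact disjoint_atom B D fun h' => h (congrArg _ h')
  have hi := (hN.iIndepFun_apply K hK hKd).indepFun_finset
    (Finset.univ.filter fun t : T => t.isLeft) (Finset.univ.filter fun t : T => t.isRight)
    (by
      rw [Finset.disjoint_left]
      rintro (a | a) <;> simp) (fun t => hN.measurable_apply (hK t))
  have h2 := hi.comp
    (φ := fun (v : (Finset.univ.filter fun t : T => t.isLeft) → ℝ≥0∞) (i : I) =>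
      ∑' a : {a : I → Prop // a i}, v ⟨Sum.inl a.1, by simp⟩)
    (ψ := fun (v : (Finset.univ.filter fun t : T => t.isRight) → ℝ≥0∞) (j : J) =>
      ∑' a : {a : J → Prop // a j}, v ⟨Sum.inr a.1, by simp⟩)
    (measurable_pi_lambda _ fun i => Measurable.tsum fun a => by fun_prop)
    (measurable_pi_lambda _ fun i => Measurable.tsum fun a => by fun_prop)
  convert h2 using 1
  · ext θ i
    exact measure_inter_eq_sum_atom hA hC (N θ) i
  · ext θ j
    exact measure_inter_eq_sum_atom hB hD (N θ) j

/-- The restrictions of a Poisson random measure to disjoint sets are independent. -/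
theorem indepFun_restrict [IsProbabilityMeasure P] (hN : IsPoissonRandomMeasure P ν N) {A B : Set X}
    (hA : MeasurableSet A) (hB : MeasurableSet B) (hAB : Disjoint A B) :
    IndepFun (fun θ => (N θ).restrict A) (fun θ => (N θ).restrict B) P := by
  have key : IndepFun (fun θ (C : {C : Set X // MeasurableSet C}) => N θ (C.1 ∩ A))
      (fun θ (C : {C : Set X // MeasurableSet C}) => N θ (C.1 ∩ B)) P :=
    ProbabilityTheory.IndepFun.process_indepFun_process
      (𝓧 := fun _ : {C : Set X // MeasurableSet C} => ℝ≥0∞)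
      (𝓨 := fun _ : {C : Set X // MeasurableSet C} => ℝ≥0∞)
      (X := fun C θ => N θ (C.1 ∩ A)) (Y := fun C θ => N θ (C.1 ∩ B))
      (fun C => hN.measurable_apply (C.2.inter hA)) (fun C => hN.measurable_apply (C.2.inter hB))
      (fun I J => hN.indepFun_inter_finite hA hB hAB (fun i : I => i.1.1) (fun i => i.1.2)
        (fun j : J => j.1.1) (fun j => j.1.2))
  -- The σ-algebra on measures is generated by evaluations, so the restriction carries no more
  -- information than the counts of the sets `C ∩ A`.
  have hle : ∀ A : Set X, MeasurableSpace.comap (fun θ => (N θ).restrict A) inferInstance ≤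
      MeasurableSpace.comap (fun θ (C : {C : Set X // MeasurableSet C}) => N θ (C.1 ∩ A))
        MeasurableSpace.pi := by
    intro A
    refine Measurable.comap_le ?_
    refine Measure.measurable_of_measurable_coe _ fun C hC => ?_
    simp_rw [Measure.restrict_apply hC]
    exact (measurable_pi_apply (X := fun _ : {C : Set X // MeasurableSet C} => ℝ≥0∞)
      ⟨C, hC⟩).comp (comap_measurable _)
  rw [IndepFun_iff_Indep] at key ⊢
  exact indep_of_indep_of_le_left (indep_of_indep_of_le_right key (hle B)) (hle A)

end Independence

end IsPoissonRandomMeasure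


/-! ### Bounds for the compensator -/

theorem IsCompensator.exists_bound {h : ℝ → ℝ} (hh : IsCompensator h) :
    ∃ C : ℝ, 0 ≤ C ∧ (∀ β, h β ^ 2 ≤ C * min 1 (β ^ 2)) ∧
      ∀ β, |β| ≤ 1 → |β - h β| ≤ C * min 1 (β ^ 2) := by
  obtain ⟨M, hM⟩ := hh.bounded
  have hM0 : 0 ≤ M := (abs_nonneg _).trans (hM 0)
  obtain ⟨c, hc0, hc⟩ := hh.isBigO.exists_nonneg
  rw [IsBigOWith, Metric.eventually_nhds_iff] at hc
  obtain ⟨δ, hδ, hc⟩ := hc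
  simp only [dist_zero_right, Real.norm_eq_abs, abs_pow, sq_abs] at hc
  -- The constant `c` serves for `|β| < δ`. For `δ ≤ |β| ≤ 1` the crude bound `1 + M` is at most `(1
  -- + M) β² / δ²`.
  have h1 : ∀ β, |β| ≤ 1 → |β - h β| ≤ (c + (1 + M) / δ ^ 2) * β ^ 2 := by
    intro β hβ
    by_cases hb : |β| < δ
    · rw [abs_sub_comm]
      refine (hc hb).trans (mul_le_mul_of_nonneg_right ?_ (sq_nonneg _))
      have : 0 ≤ (1 + M) / δ ^ 2 := by positivity
      linarith
    · push Not at hb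
      have h2 : |β - h β| ≤ 1 + M := (abs_sub _ _).trans (add_le_add hβ (hM β))
      have h3 : 1 ≤ β ^ 2 / δ ^ 2 := by
        rw [one_le_div (by positivity), ← sq_abs β]
        gcongr
      calc |β - h β| ≤ (1 + M) * 1 := by linarith
        _ ≤ (1 + M) * (β ^ 2 / δ ^ 2) := by gcongr
        _ = (0 + (1 + M) / δ ^ 2) * β ^ 2 := by ring
        _ ≤ _ := by gcongr
  set K := c + (1 + M) / δ ^ 2 with hK
  have hK0 : 0 ≤ K := by positivity
  -- The three summands cover `|β - h|` for `|β| ≤ 1`, `h²` for `|β| ≤ 1` (where `|h| ≤ (1 + K)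
  -- |β|`), and `h²` for `|β| ≥ 1`.
  refine ⟨K + (1 + K) ^ 2 + M ^ 2, by positivity, fun β => ?_, fun β hβ => ?_⟩
  · rcases le_total |β| 1 with hβ | hβ
    · have hb2 : β ^ 2 ≤ 1 := (sq_le_one_iff_abs_le_one β).2 hβ
      rw [min_eq_right hb2]
      have h2 : |h β| ≤ (1 + K) * |β| := by
        have h3 := h1 β hβ
        have h4 : |h β| ≤ |β| + |β - h β| := by
          have := abs_sub_abs_le_abs_sub (h β) β
          rw [abs_sub_comm] at this
          linarith
        have h5 : β ^ 2 ≤ |β| := by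
          rw [← sq_abs]
          nlinarith [abs_nonneg β]
        nlinarith
      have h3 : h β ^ 2 ≤ (1 + K) ^ 2 * β ^ 2 := by
        rw [← sq_abs (h β), ← sq_abs β, ← mul_pow]
        gcongr
      refine h3.trans (mul_le_mul_of_nonneg_right ?_ (sq_nonneg _))
      nlinarith [sq_nonneg M]
    · have hb2 : 1 ≤ β ^ 2 := (one_le_sq_iff_one_le_abs β).2 hβ
      rw [min_eq_left hb2, mul_one, ← sq_abs]
      have : |h β| ^ 2 ≤ M ^ 2 := by gcongr; exact hM β
      nlinarith [sq_nonneg (1 + K)]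
  · have hb2 : β ^ 2 ≤ 1 := (sq_le_one_iff_abs_le_one β).2 hβ
    rw [min_eq_right hb2]
    refine (h1 β hβ).trans (mul_le_mul_of_nonneg_right ?_ (sq_nonneg _))
    nlinarith [sq_nonneg M, sq_nonneg (1 + K)]

/-- The points whose mark `b` exceeds `ε` in absolute value. -/
def bigJumps {X : Type*} (b : X → ℝ) (ε : ℝ) : Set X := {p | ε < |b p|}

/-! ### Truncation by jump size -/

section BigJumps

variable {X : Type*} [MeasurableSpace X] {b : X → ℝ}

theorem measurableSet_bigJumps (hb : Measurable b) (ε : ℝ) : MeasurableSet (bigJumps b ε) :=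
  measurableSet_lt measurable_const (by fun_prop)

theorem bigJumps_anti {X : Type*} {b : X → ℝ} {δ ε : ℝ} (h : δ ≤ ε) :
    bigJumps b ε ⊆ bigJumps b δ := fun _ hp => h.trans_lt hp

/-- Markov's inequality: `1 ∧ b²` is at least `1 ∧ ε²` on this set. -/
theorem measure_bigJumps_lt_top {ν : Measure X} (hb : Measurable b)
    (hν1 : ∫⁻ p, ENNReal.ofReal (min 1 (b p ^ 2)) ∂ν ≠ ∞) {ε : ℝ} (hε : 0 < ε) :
    ν (bigJumps b ε) < ∞ := by
  have h1 := mul_meas_ge_le_lintegral (μ := ν)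
    (f := fun p => ENNReal.ofReal (min 1 (b p ^ 2))) (by fun_prop) (ENNReal.ofReal (min 1 (ε ^ 2)))
  have hpos : ENNReal.ofReal (min 1 (ε ^ 2)) ≠ 0 := by
    rw [Ne, ENNReal.ofReal_eq_zero, not_le]
    positivity
  have h2 : bigJumps b ε ⊆
      {p | ENNReal.ofReal (min 1 (ε ^ 2)) ≤ ENNReal.ofReal (min 1 (b p ^ 2))} := by
    intro p hp
    refine ENNReal.ofReal_le_ofReal (min_le_min_left _ ?_)
    rw [← sq_abs (b p)]
    have : ε < |b p| := hp
    gcongr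
  refine (measure_mono h2).trans_lt ?_
  by_contra hcon
  rw [not_lt, top_le_iff] at hcon
  rw [hcon, ENNReal.mul_top hpos, top_le_iff] at h1
  exact hν1 h1

theorem sigmaFinite_of_bigJumps {ν : Measure X} (hb : Measurable b) (hν0 : ν {p | b p = 0} = 0)
    (hν1 : ∫⁻ p, ENNReal.ofReal (min 1 (b p ^ 2)) ∂ν ≠ ∞) : SigmaFinite ν := by
  refine ⟨⟨⟨fun n => {p | b p = 0} ∪ bigJumps b (1 / (n + 1)), fun n => trivial, fun n => ?_, ?_⟩⟩⟩
  · refine (measure_union_le _ _).trans_lt ?_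
    rw [hν0, zero_add]
    exact measure_bigJumps_lt_top hb hν1 (by positivity)
  · refine Set.eq_univ_of_forall fun p => ?_
    rw [Set.mem_iUnion]
    by_cases hp : b p = 0
    · exact ⟨0, Or.inl hp⟩
    · obtain ⟨n, hn⟩ := exists_nat_one_div_lt (abs_pos.2 hp)
      exact ⟨n, Or.inr hn⟩

/-- Right continuity of the integral over the jumps of size larger than `ε`. -/
theorem tendsto_setIntegral_bigJumps {E : Type*} [NormedAddCommGroup E] [NormedSpace ℝ E]
    (hb : Measurable b) {m : Measure X} {g : X → E} {ε : ℝ}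
    (hg : IntegrableOn g (bigJumps b ε) m) :
    Tendsto (fun δ => ∫ p in bigJumps b δ, g p ∂m) (𝓝[>] ε) (𝓝 (∫ p in bigJumps b ε, g p ∂m)) := by
  have hm := measurableSet_bigJumps hb
  simp_rw [← integral_indicator (hm _)]
  refine tendsto_integral_filter_of_dominated_convergence
    (fun p => ‖(bigJumps b ε).indicator g p‖) ?_ ?_ ((integrable_indicator_iff (hm ε)).2 hg).norm ?_
  · filter_upwards [self_mem_nhdsWithin] with δ hδ
    exact ((integrable_indicator_iff (hm δ)).2
      (hg.mono_set (bigJumps_anti (le_of_lt hδ)))).aestronglyMeasurable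
  · filter_upwards [self_mem_nhdsWithin] with δ hδ
    exact ae_of_all _ fun p =>
      norm_indicator_le_of_subset (bigJumps_anti (le_of_lt hδ)) _ _
  · refine ae_of_all _ fun p => ?_
    refine tendsto_const_nhds.congr' ?_
    -- Since the inequality in `bigJumps` is strict, a point with `ε < |b p|` still belongs to
    -- `bigJumps b δ` for `δ` slightly above `ε`; this is the source of right continuity.
    by_cases hp : p ∈ bigJumps b ε
    · have : ∀ᶠ δ in 𝓝[>] ε, δ < |b p| := nhdsWithin_le_nhds (eventually_lt_nhds hp)
      filter_upwards [this] with δ hδ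
      rw [Set.indicator_of_mem hp, Set.indicator_of_mem (show p ∈ bigJumps b δ from hδ)]
    · filter_upwards [self_mem_nhdsWithin] with δ hδ
      rw [Set.indicator_of_notMem hp,
        Set.indicator_of_notMem fun h => hp (bigJumps_anti (le_of_lt hδ) h)]

/-- If there are no points with mark `0`, integrals over the jumps of size larger than `ε`
exhaust the integral. -/
theorem tendsto_setIntegral_bigJumps_zero {E : Type*} [NormedAddCommGroup E] [NormedSpace ℝ E]
    (hb : Measurable b) {m : Measure X} (hm0 : m {p | b p = 0} = 0) {g : X → E}
    (hg : Integrable g m) :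
    Tendsto (fun δ => ∫ p in bigJumps b δ, g p ∂m) (𝓝[>] 0) (𝓝 (∫ p, g p ∂m)) := by
  have h := tendsto_setIntegral_bigJumps hb (ε := 0) hg.integrableOn
  have h2 : bigJumps b 0 =ᵐ[m] Set.univ := by
    rw [ae_eq_univ]
    convert hm0 using 2
    ext p
    simp [bigJumps]
  rwa [setIntegral_congr_set h2, setIntegral_univ] at h

/-- The mass of a finite integral over small jumps vanishes. -/
theorem tendsto_setLIntegral_compl_bigJumps (hb : Measurable b) {m : Measure X}
    (hm0 : m {p | b p = 0} = 0) {g : X → ℝ≥0∞} (hg : Measurable g) (hfin : ∫⁻ p, g p ∂m ≠ ∞) :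
    Tendsto (fun n : ℕ => ∫⁻ p in (bigJumps b (1 / ((n : ℝ) + 1)))ᶜ, g p ∂m) atTop (𝓝 0) := by
  have hm := fun ε => (measurableSet_bigJumps hb ε).compl
  simp_rw [← lintegral_indicator (hm _)]
  have h0 : ∫⁻ p, (0 : X → ℝ≥0∞) p ∂m = 0 := by simp
  rw [← h0]
  refine tendsto_lintegral_of_dominated_convergence g (fun n => hg.indicator (hm _))
    (fun n => ae_of_all _ fun p => Set.indicator_le_self _ _ _) hfin ?_
  have hae : ∀ᵐ p ∂m, b p ≠ 0 := by
    rw [ae_iff]; simpa using hm0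
  filter_upwards [hae] with p hp
  refine tendsto_const_nhds.congr' ?_
  have h1 : ∀ᶠ n : ℕ in atTop, 1 / ((n : ℝ) + 1) < |b p| :=
    tendsto_one_div_add_atTop_nhds_zero_nat.eventually_lt_const (abs_pos.2 hp)
  filter_upwards [h1] with n hn
  rw [Set.indicator_of_notMem]
  · rfl
  · simpa [bigJumps] using hn

end BigJumps

/-! ### Integrability on sets of finite intensity -/

namespace IsPoissonRandomMeasure

variable {S X : Type*} [MeasurableSpace S] [MeasurableSpace X]
  {P : Measure S} {ν : Measure X} {N : S → Measure X}

theorem measure_apply_ne_zero [IsProbabilityMeasure P] (hN : IsPoissonRandomMeasure P ν N)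
    {C : Set X} (hC : MeasurableSet C) (hνC : ν C ≠ ∞) :
    P {θ | N θ C ≠ 0} = 1 - ENNReal.ofReal (Real.exp (-ν.real C)) := by
  have h1 : P {θ | N θ C = 0} = ENNReal.ofReal (Real.exp (-ν.real C)) := by
    have h2 : P.map (fun θ => N θ C) {0} = P {θ | N θ C = 0} := by
      rw [Measure.map_apply (hN.measurable_apply hC) (measurableSet_singleton 0)]
      rfl
    rw [← h2, hN.map_eq C hC hνC, Measure.map_apply (by fun_prop) (measurableSet_singleton 0)]
    have h3 : (fun n : ℕ => (n : ℝ≥0∞)) ⁻¹' {0} = {0} := by ext n; simp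
    rw [h3, poissonMeasure_singleton]
    simp [real_eq]
  have h4 : {θ | N θ C ≠ 0} = {θ | N θ C = 0}ᶜ := rfl
  have h5 : MeasurableSet {θ | N θ C = 0} := hN.measurable_apply hC (measurableSet_singleton 0)
  rw [h4, prob_compl_eq_one_sub h5, h1]

/-- On a set of finite intensity every measurable function is integrable with respect to almost
every realisation of the random measure. -/
theorem ae_integrableOn_of_measure_ne_top [IsProbabilityMeasure P] [SigmaFinite ν]
    (hN : IsPoissonRandomMeasure P ν N)
    {E : Type*} [NormedAddCommGroup E] {g : X → E} (hg : StronglyMeasurable g)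
    {A : Set X} (hA : MeasurableSet A) (hνA : ν A ≠ ∞) :
    ∀ᵐ θ ∂P, IntegrableOn g A (N θ) := by
  -- `B n` contains a point of `N` with probability `1 - exp (-ν (B n))`, which tends to `0`. So
  -- almost surely some `B n` is empty of points, and `g` is bounded by `n` on the remaining ones,
  -- with `N θ A` finite.
  set B : ℕ → Set X := fun n => A ∩ {p | (n : ℝ) < ‖g p‖} with hB
  have hBm : ∀ n, MeasurableSet (B n) := fun n =>
    hA.inter (measurableSet_lt measurable_const hg.norm.measurable)
  have hBfin : ∀ n, ν (B n) ≠ ∞ := fun n =>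
    ((measure_mono Set.inter_subset_left).trans_lt hνA.lt_top).ne
  have hBanti : Antitone B := by
    intro i j hij p hp
    exact ⟨hp.1, lt_of_le_of_lt (Nat.cast_le.2 hij) (show (j : ℝ) < ‖g p‖ from hp.2)⟩
  have hBlim : Tendsto (fun n => ν (B n)) atTop (𝓝 0) := by
    have := tendsto_measure_iInter_atTop (μ := ν) (fun n => (hBm n).nullMeasurableSet) hBanti
      ⟨0, hBfin 0⟩
    have he : ⋂ n, B n = ∅ := by
      refine Set.eq_empty_of_forall_notMem fun p hp => ?_
      obtain ⟨n, hn⟩ := exists_nat_gt ‖g p‖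
      exact absurd (Set.mem_iInter.1 hp n).2 (not_lt.2 hn.le)
    rwa [he, measure_empty] at this
  have hlim : Tendsto (fun n => P {θ | N θ (B n) ≠ 0}) atTop (𝓝 0) := by
    have h1 : Tendsto (fun n => ν.real (B n)) atTop (𝓝 0) := by
      exact (ENNReal.tendsto_toReal ENNReal.zero_ne_top).comp hBlim
    have h2 : Tendsto (fun n => 1 - ENNReal.ofReal (Real.exp (-ν.real (B n)))) atTop
        (𝓝 (1 - ENNReal.ofReal (Real.exp (-0)))) := by
      refine ENNReal.Tendsto.sub tendsto_const_nhds ?_ (Or.inl ENNReal.one_ne_top)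
      exact ENNReal.tendsto_ofReal ((Real.continuous_exp.tendsto _).comp h1.neg)
    simp only [neg_zero, Real.exp_zero, ENNReal.ofReal_one, tsub_self] at h2
    exact h2.congr fun n => (hN.measure_apply_ne_zero (hBm n) (hBfin n)).symm
  have hae : ∀ᵐ θ ∂P, ∃ n, N θ (B n) = 0 := by
    rw [ae_iff]
    refine le_antisymm (ge_of_tendsto' hlim fun n => measure_mono fun θ hθ => ?_) zero_le
    simp only [not_exists, Set.mem_ofPred_eq] at hθ
    exact hθ n
  have hfin : ∀ᵐ θ ∂P, N θ A < ∞ := by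
    have := hN.ae_lintegral_lt_top (g := A.indicator 1) (measurable_one.indicator hA)
      (by rwa [lintegral_indicator_one hA])
    simpa [lintegral_indicator_one hA] using this
  filter_upwards [hae, hfin] with θ ⟨n, hn⟩ hθ
  refine Measure.integrableOn_of_bounded hθ.ne hg.aestronglyMeasurable (M := n) ?_
  rw [ae_restrict_iff' hA, ae_iff]
  refine measure_mono_null (fun p hp => ?_) hn
  simp only [Set.mem_ofPred_eq, Classical.not_imp, not_le] at hp
  exact ⟨hp.1, hp.2⟩

end IsPoissonRandomMeasure


/-- The integral of `g` over `A` with respect to the signed measure `m - ν`. -/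
noncomputable def compInt {X H : Type*} [MeasurableSpace X] [NormedAddCommGroup H] [NormedSpace ℝ H]
    (ν m : Measure X) (g : X → H) (A : Set X) : H :=
  (∫ p in A, g p ∂m) - ∫ p in A, g p ∂ν

section CompInt

variable {X H : Type*} [MeasurableSpace X] [NormedAddCommGroup H] [NormedSpace ℝ H]

theorem compInt_sdiff {ν m : Measure X} {g : X → H} {A B : Set X} (hBA : B ⊆ A)
    (hB : MeasurableSet B) (hν : IntegrableOn g A ν) (hm : IntegrableOn g A m) :
    compInt ν m g (A \ B) = compInt ν m g A - compInt ν m g B := by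
  rw [compInt, setIntegral_sdiff hB hν hBA, setIntegral_sdiff hB hm hBA, compInt, compInt]
  abel

/-- Exhibits the compensated integral over `B` as a function of the restriction of the random
measure to `A`, the form in which independence applies. -/
theorem compInt_restrict (ν m : Measure X) (g : X → H) {A B : Set X} (hBA : B ⊆ A)
    (hB : MeasurableSet B) : compInt ν (m.restrict A) g B = compInt ν m g B := by
  rw [compInt, compInt, Measure.restrict_restrict hB, Set.inter_eq_left.2 hBA]

theorem stronglyMeasurable_compInt [CompleteSpace H] (ν : Measure X) {g : X → H}
    (hg : StronglyMeasurable g) {A : Set X} (hA : MeasurableSet A) :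
    StronglyMeasurable fun m => compInt ν m g A := by
  simp_rw [compInt, ← integral_indicator hA]
  exact (stronglyMeasurable_integral_measure (hg.indicator hA)).sub stronglyMeasurable_const

end CompInt

/-! ### Ottaviani's inequality and almost sure convergence -/

namespace IsPoissonRandomMeasure

variable {S X : Type*} [MeasurableSpace S] [MeasurableSpace X]
  {P : Measure S} {ν : Measure X} {N : S → Measure X} [IsProbabilityMeasure P] [SigmaFinite ν]
  {H : Type*} [NormedAddCommGroup H] [InnerProductSpace ℝ H] [CompleteSpace H]

theorem lintegral_compInt_sq_le (hN : IsPoissonRandomMeasure P ν N) {g : X → H}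
    (h2 : MemLp g 2 ν) {A : Set X} (hA : MeasurableSet A) (h1 : IntegrableOn g A ν) :
    ∫⁻ θ, ‖compInt ν (N θ) g A‖ₑ ^ 2 ∂P ≤ ∫⁻ p in A, ‖g p‖ₑ ^ 2 ∂ν := by
  have h := hN.eLpNorm_compensated_le (g := A.indicator g)
    ((integrable_indicator_iff hA).2 h1) (h2.indicator hA)
  simp_rw [integral_indicator hA] at h
  rw [eLpNorm_indicator_eq_eLpNorm_restrict hA, eLpNorm_two_eq_lintegral, eLpNorm_two_eq_lintegral] at h
  exact (ENNReal.rpow_le_rpow_iff (by norm_num)).1 h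

theorem measure_lt_norm_compInt_le (hN : IsPoissonRandomMeasure P ν N) {g : X → H}
    (hg : StronglyMeasurable g) (h2 : MemLp g 2 ν) {A : Set X} (hA : MeasurableSet A)
    (h1 : IntegrableOn g A ν) {l : ℝ} (hl : 0 < l) :
    P {θ | l < ‖compInt ν (N θ) g A‖} ≤ (∫⁻ p in A, ‖g p‖ₑ ^ 2 ∂ν) / ENNReal.ofReal l ^ 2 := by
  have hm := ((stronglyMeasurable_compInt ν hg hA).comp_measurable hN.measurable).enorm
  have h := meas_ge_le_lintegral_div (μ := P) (f := fun θ => ‖compInt ν (N θ) g A‖ₑ ^ 2)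
    (hm.pow_const 2).aemeasurable (ε := ENNReal.ofReal l ^ 2) (by simpa using hl) (by simp)
  refine (measure_mono fun θ hθ => ?_).trans
    (h.trans (ENNReal.div_le_div_right (hN.lintegral_compInt_sq_le h2 hA h1) _))
  have : l < ‖compInt ν (N θ) g A‖ := hθ
  simp only [Set.mem_ofPred_eq]
  rw [← ofReal_norm]
  gcongr

/-- Ottaviani's maximal inequality for the compensated integrals over `ε < |b| ≤ ε₀`. -/
theorem measure_exists_lt_norm_compInt_le (hN : IsPoissonRandomMeasure P ν N) {g : X → H}
    (hg : StronglyMeasurable g) (h2 : MemLp g 2 ν) {b : X → ℝ} (hb : Measurable b)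
    (h1 : ∀ ε, 0 < ε → IntegrableOn g (bigJumps b ε) ν) {ε₀ l : ℝ} (hl : 0 < l)
    (hσ : (∫⁻ p in (bigJumps b ε₀)ᶜ, ‖g p‖ₑ ^ 2 ∂ν) / ENNReal.ofReal l ^ 2 ≤ 1 / 2)
    (I : Finset ℝ) (hI : ∀ ε ∈ I, 0 < ε ∧ ε ≤ ε₀) :
    P {θ | ∃ ε ∈ I, 2 * l < ‖compInt ν (N θ) g (bigJumps b ε \ bigJumps b ε₀)‖} ≤
      2 * ((∫⁻ p in (bigJumps b ε₀)ᶜ, ‖g p‖ₑ ^ 2 ∂ν) / ENNReal.ofReal l ^ 2) := by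
  classical
  rcases I.eq_empty_or_nonempty with rfl | hne
  · simp
  set c := (∫⁻ p in (bigJumps b ε₀)ᶜ, ‖g p‖ₑ ^ 2 ∂ν) / ENNReal.ofReal l ^ 2 with hc
  set η := I.min' hne with hη
  have hηI : η ∈ I := I.min'_mem hne
  have hηle : ∀ ε ∈ I, η ≤ ε := fun ε hε => I.min'_le ε hε
  have hJ := fun ε => measurableSet_bigJumps hb ε
  set Z : ℝ → Measure X → H := fun ε m => compInt ν m g (bigJumps b ε \ bigJumps b ε₀) with hS
  have hSm : ∀ ε, StronglyMeasurable (Z ε) := fun ε =>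
    stronglyMeasurable_compInt ν hg ((hJ ε).diff (hJ ε₀))
  set R : ℝ → Measure X → H := fun ε m => compInt ν m g (bigJumps b η \ bigJumps b ε) with hR
  have hRm : ∀ ε, StronglyMeasurable (R ε) := fun ε =>
    stronglyMeasurable_compInt ν hg ((hJ η).diff (hJ ε))
  -- First exit when the levels are scanned downwards from `ε₀`: `ε` violates the bound and no
  -- larger level of `I` does.
  set T : ℝ → Set (Measure X) := fun ε =>
    {m | 2 * l < ‖Z ε m‖} ∩ ⋂ δ ∈ I.filter (ε < ·), {m | ‖Z δ m‖ ≤ 2 * l} with hT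
  have hTm : ∀ ε, MeasurableSet (T ε) := fun ε =>
    (measurableSet_lt measurable_const (hSm ε).norm.measurable).inter
      (Finset.measurableSet_biInter _ fun δ _ =>
        measurableSet_le (hSm δ).norm.measurable measurable_const)
  have hcheb : ∀ ε, ε ≤ ε₀ → ∀ δ, 0 < δ →
      P {θ | l < ‖compInt ν (N θ) g (bigJumps b δ \ bigJumps b ε)‖} ≤ c := by
    intro ε hε δ hδ
    refine (hN.measure_lt_norm_compInt_le hg h2 ((hJ δ).diff (hJ ε))
      ((h1 δ hδ).mono_set Set.sdiff_subset) hl).trans (ENNReal.div_le_div_right ?_ _)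
    exact lintegral_mono_set fun p hp => fun h => hp.2 (bigJumps_anti hε h)
  have hη0 := (hI η hηI).1
  set B : ℝ → Set S := fun ε => {θ | N θ ∈ T ε} ∩ {θ | ‖R ε (N θ)‖ ≤ l} with hB
  have hBm : ∀ ε, MeasurableSet (B ε) := fun ε =>
    (hN.measurable (hTm ε)).inter
      (measurableSet_le ((hRm ε).norm.measurable.comp hN.measurable) measurable_const)
  have hhalf : ∀ ε ∈ I, P {θ | N θ ∈ T ε} ≤ 2 * P (B ε) := by
    intro ε hε
    have hind := hN.indepFun_restrict (hJ ε) ((hJ η).diff (hJ ε)) Set.disjoint_sdiff_right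
    -- `T ε` involves only levels at or above `ε`, hence only jumps larger than `ε`, whereas `R ε`
    -- sees only jumps in `(η, ε]`.
    have e1 : {θ | N θ ∈ T ε} = (fun θ => (N θ).restrict (bigJumps b ε)) ⁻¹' T ε := by
      ext θ
      have : ∀ δ, ε ≤ δ → Z δ ((N θ).restrict (bigJumps b ε)) = Z δ (N θ) := fun δ hδ =>
        compInt_restrict _ _ _ (Set.sdiff_subset.trans (bigJumps_anti hδ)) ((hJ δ).diff (hJ ε₀))
      simp only [hT, Set.mem_ofPred_eq, Set.mem_preimage, Set.mem_inter_iff, Set.mem_iInter,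
        Finset.mem_filter, this ε le_rfl]
      refine and_congr_right fun _ => forall_congr' fun δ => forall_congr' fun hδ => ?_
      rw [this δ hδ.2.le]
    have e2 : {θ | ‖R ε (N θ)‖ ≤ l} =
        (fun θ => (N θ).restrict (bigJumps b η \ bigJumps b ε)) ⁻¹' {m | ‖R ε m‖ ≤ l} := by
      ext θ
      simp only [Set.mem_ofPred_eq, Set.mem_preimage, hR,
        compInt_restrict _ _ _ subset_rfl ((hJ η).diff (hJ ε))]
    have hmul := hind.measure_inter_preimage_eq_mul (T ε) {m | ‖R ε m‖ ≤ l} (hTm ε)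
      (measurableSet_le (hRm ε).norm.measurable measurable_const)
    rw [← e1, ← e2] at hmul
    have hge : (1 / 2 : ℝ≥0∞) ≤ P {θ | ‖R ε (N θ)‖ ≤ l} := by
      have hco : {θ | ‖R ε (N θ)‖ ≤ l} = {θ | l < ‖R ε (N θ)‖}ᶜ := by
        ext θ; simp
      have hmm : MeasurableSet {θ | l < ‖R ε (N θ)‖} :=
        measurableSet_lt measurable_const ((hRm ε).norm.measurable.comp hN.measurable)
      rw [hco, prob_compl_eq_one_sub hmm]
      have := (hcheb ε (hI ε hε).2 η hη0).trans hσ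
      calc (1 / 2 : ℝ≥0∞) = 1 - 1 / 2 := by simp
        _ ≤ _ := tsub_le_tsub_left this _
    calc P {θ | N θ ∈ T ε} = 2 * (P {θ | N θ ∈ T ε} * (1 / 2)) := by
          rw [mul_comm _ (1 / 2 : ℝ≥0∞), ← mul_assoc, one_div,
            ENNReal.mul_inv_cancel (by simp) (by simp), one_mul]
      _ ≤ 2 * (P {θ | N θ ∈ T ε} * P {θ | ‖R ε (N θ)‖ ≤ l}) := by gcongr
      _ = 2 * P (B ε) := by rw [hB, hmul]
  have hdisj : ((I : Set ℝ)).PairwiseDisjoint B := by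
    have key : ∀ ε ∈ I, ∀ δ ∈ I, ε < δ → Disjoint (B ε) (B δ) := by
      intro ε _ δ hδ hlt
      rw [Set.disjoint_left]
      rintro θ ⟨⟨_, hθ⟩, _⟩ ⟨⟨hθ', _⟩, _⟩
      simp only [Set.mem_iInter, Finset.mem_filter, Set.mem_ofPred_eq] at hθ hθ'
      exact absurd hθ' (not_lt.2 (hθ δ ⟨hδ, hlt⟩))
    intro ε hε δ hδ hne
    rcases lt_or_gt_of_ne hne with h | h
    · exact key ε hε δ hδ h
    · exact (key δ hδ ε hε h).symm
  have hae : ∀ᵐ θ ∂P, IntegrableOn g (bigJumps b η) (N θ) := by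
    filter_upwards [hN.ae_integrable ((integrable_indicator_iff (hJ η)).2 (h1 η hη0))] with θ hθ
    exact (integrable_indicator_iff (hJ η)).1 hθ
  -- On `B ε` the integral down to `ε` exceeds `2 l` and the rest down to the lowest level `η` is at
  -- most `l`, so the integral down to `η` exceeds `l`. One Chebyshev bound then covers all `ε`.
  have hunion : P (⋃ ε ∈ I, B ε) ≤ c := by
    refine le_trans (measure_mono_ae ?_) (hcheb ε₀ le_rfl η hη0)
    filter_upwards [hae] with θ hθ hmem
    obtain ⟨ε, hε, ⟨⟨hθ1, _⟩, hθ2⟩⟩ := Set.mem_iUnion₂.1 (show θ ∈ ⋃ ε ∈ I, B ε from hmem)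
    change l < ‖compInt ν (N θ) g (bigJumps b η \ bigJumps b ε₀)‖
    change 2 * l < ‖compInt ν (N θ) g (bigJumps b ε \ bigJumps b ε₀)‖ at hθ1
    change ‖compInt ν (N θ) g (bigJumps b η \ bigJumps b ε)‖ ≤ l at hθ2
    have hsub := bigJumps_anti (b := b) (hηle ε hε)
    have hsub0 := bigJumps_anti (b := b) (hI ε hε).2
    have hνη := h1 η hη0
    rw [compInt_sdiff hsub0 (hJ _) (hνη.mono_set hsub) (hθ.mono_set hsub)] at hθ1
    rw [compInt_sdiff hsub (hJ _) hνη hθ] at hθ2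
    rw [compInt_sdiff (hsub0.trans hsub) (hJ _) hνη hθ]
    have htri := norm_sub_le
      (compInt ν (N θ) g (bigJumps b η) - compInt ν (N θ) g (bigJumps b ε₀))
      (compInt ν (N θ) g (bigJumps b η) - compInt ν (N θ) g (bigJumps b ε))
    rw [sub_sub_sub_cancel_left] at htri
    linarith
  calc P {θ | ∃ ε ∈ I, 2 * l < ‖compInt ν (N θ) g (bigJumps b ε \ bigJumps b ε₀)‖}
      ≤ P (⋃ ε ∈ I, {θ | N θ ∈ T ε}) := by
        refine measure_mono ?_
        rintro θ ⟨ε, hε, hθ⟩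
        set K := I.filter fun ε => 2 * l < ‖Z ε (N θ)‖ with hK
        have hKne : K.Nonempty := ⟨ε, Finset.mem_filter.2 ⟨hε, hθ⟩⟩
        have hmax := Finset.mem_filter.1 (K.max'_mem hKne)
        simp only [Set.mem_iUnion]
        refine ⟨K.max' hKne, hmax.1, hmax.2, ?_⟩
        simp only [Set.mem_iInter, Finset.mem_filter, Set.mem_ofPred_eq]
        rintro δ ⟨hδ, hlt⟩
        by_contra hcon
        exact absurd (K.le_max' δ (Finset.mem_filter.2 ⟨hδ, not_le.1 hcon⟩)) (not_le.2 hlt)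
    _ ≤ ∑ ε ∈ I, P {θ | N θ ∈ T ε} := measure_biUnion_finset_le _ _
    _ ≤ ∑ ε ∈ I, 2 * P (B ε) := Finset.sum_le_sum hhalf
    _ = 2 * P (⋃ ε ∈ I, B ε) := by
        rw [measure_biUnion_finset hdisj fun ε _ => hBm ε, Finset.mul_sum]
    _ ≤ 2 * c := by gcongr

/-- The compensated integrals over the jumps of size larger than `ε` converge almost surely, along
the continuous parameter `ε → 0`. -/
theorem ae_exists_tendsto_compInt (hN : IsPoissonRandomMeasure P ν N) {g : X → H}
    (hg : StronglyMeasurable g) (h2 : MemLp g 2 ν) {b : X → ℝ} (hb : Measurable b)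
    (hν0 : ν {p | b p = 0} = 0) (h1 : ∀ ε, 0 < ε → IntegrableOn g (bigJumps b ε) ν) :
    ∀ᵐ θ ∂P, ∃ u, Tendsto (fun ε => compInt ν (N θ) g (bigJumps b ε)) (𝓝[>] 0) (𝓝 u) := by
  have hJ := fun ε => measurableSet_bigJumps hb ε
  have hint : ∀ᵐ θ ∂P, ∀ n : ℕ, IntegrableOn g (bigJumps b (1 / ((n : ℝ) + 1))) (N θ) := by
    refine ae_all_iff.2 fun n => ?_
    filter_upwards [hN.ae_integrable ((integrable_indicator_iff (hJ _)).2
      (h1 (1 / ((n : ℝ) + 1)) (by positivity)))] with θ hθ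
    exact (integrable_indicator_iff (hJ _)).1 hθ
  have hσlim := tendsto_setLIntegral_compl_bigJumps hb hν0 (g := fun p => ‖g p‖ₑ ^ 2)
    (hg.enorm.pow_const 2) (by
      have := h2.2
      rw [eLpNorm_two_eq_lintegral] at this
      exact ((ENNReal.rpow_lt_top_iff_of_pos (by norm_num)).1 this).ne)
  -- Restricting to rational levels makes the event a directed union over finite sets of levels;
  -- Ottaviani's bound does not depend on the finite set.
  have hosc : ∀ᵐ θ ∂P, ∀ k : ℕ, ∃ n : ℕ, ∀ q : ℚ, 0 < (q : ℝ) → (q : ℝ) ≤ 1 / ((n : ℝ) + 1) →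
      ‖compInt ν (N θ) g (bigJumps b q \ bigJumps b (1 / ((n : ℝ) + 1)))‖ ≤
        2 * (1 / ((k : ℝ) + 1)) := by
    refine ae_all_iff.2 fun k => ?_
    set l : ℝ := 1 / ((k : ℝ) + 1) with hl
    have hl0 : 0 < l := by positivity
    set c : ℕ → ℝ≥0∞ := fun n =>
      (∫⁻ p in (bigJumps b (1 / ((n : ℝ) + 1)))ᶜ, ‖g p‖ₑ ^ 2 ∂ν) / ENNReal.ofReal l ^ 2 with hc
    have hclim : Tendsto c atTop (𝓝 0) := by
      have := ENNReal.Tendsto.div_const hσlim (b := ENNReal.ofReal l ^ 2)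
        (Or.inr (by simpa using hl0))
      rwa [ENNReal.zero_div] at this
    have hclim2 : Tendsto (fun n => 2 * c n) atTop (𝓝 0) := by
      have := ENNReal.Tendsto.const_mul (a := 2) hclim (Or.inr (by simp))
      simpa using this
    rw [ae_iff]
    refine le_antisymm (ge_of_tendsto hclim2 ?_) zero_le
    filter_upwards [hclim.eventually_le_const (show (0 : ℝ≥0∞) < 1 / 2 by simp)] with n hn
    set Q := {q : ℚ // 0 < (q : ℝ) ∧ (q : ℝ) ≤ 1 / ((n : ℝ) + 1)} with hQ
    set F : Finset Q → Set S := fun I => {θ | ∃ ε ∈ I.image fun q : Q => ((q : ℚ) : ℝ),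
      2 * l < ‖compInt ν (N θ) g (bigJumps b ε \ bigJumps b (1 / ((n : ℝ) + 1)))‖} with hF
    have hFmono : Monotone F := by
      rintro I J hIJ θ ⟨ε, hε, hθ⟩
      exact ⟨ε, Finset.image_subset_image hIJ hε, hθ⟩
    have hle : P (⋃ I, F I) ≤ 2 * c n := by
      rw [hFmono.directed_le.measure_iUnion]
      refine iSup_le fun I => ?_
      refine hN.measure_exists_lt_norm_compInt_le hg h2 hb h1 hl0 hn _ fun ε hε => ?_
      obtain ⟨q, _, rfl⟩ := Finset.mem_image.1 hε
      exact q.2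
    refine le_trans (measure_mono fun θ hθ => ?_) hle
    simp only [Set.mem_ofPred_eq] at hθ
    push Not at hθ
    obtain ⟨q, hq0, hq1, hq⟩ := hθ n
    exact Set.mem_iUnion.2 ⟨{⟨q, hq0, hq1⟩}, q, by simp, hq⟩
  filter_upwards [hint, hosc] with θ hθ1 hθ2
  have hint' : ∀ ε, 0 < ε → IntegrableOn g (bigJumps b ε) (N θ) := by
    intro ε hε
    obtain ⟨n, hn⟩ := exists_nat_one_div_lt hε
    exact (hθ1 n).mono_set (bigJumps_anti hn.le)
  set Φ : ℝ → H := fun ε => compInt ν (N θ) g (bigJumps b ε) with hΦ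
  have hright : ∀ ε, 0 < ε → Tendsto Φ (𝓝[>] ε) (𝓝 (Φ ε)) := fun ε hε =>
    (tendsto_setIntegral_bigJumps hb (hint' ε hε)).sub
      (tendsto_setIntegral_bigJumps hb (h1 ε hε))
  have hbound : ∀ k : ℕ, ∃ r : ℝ, 0 < r ∧ ∀ ε, 0 < ε → ε < r →
      ‖Φ ε - Φ r‖ ≤ 2 * (1 / ((k : ℝ) + 1)) := by
    intro k
    obtain ⟨n, hn⟩ := hθ2 k
    refine ⟨1 / ((n : ℝ) + 1), by positivity, fun ε hε hεr => ?_⟩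
    -- Every real level is a limit of larger rational ones, so right continuity transfers the bound.
    have hlim := ((hright ε hε).sub_const (Φ (1 / ((n : ℝ) + 1)))).norm
    refine le_of_tendsto_of_frequently hlim ?_
    rw [(nhdsGT_basis ε).frequently_iff]
    intro i hi
    obtain ⟨q, hq1, hq2⟩ := exists_rat_btwn (lt_min hi hεr)
    refine ⟨q, ⟨hq1, hq2.trans_le (min_le_left _ _)⟩, ?_⟩
    have hq0 : (0 : ℝ) < q := hε.trans hq1
    have hqr : (q : ℝ) ≤ 1 / ((n : ℝ) + 1) := hq2.le.trans (min_le_right _ _)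
    have := hn q hq0 hqr
    rwa [compInt_sdiff (bigJumps_anti hqr) (hJ _) (h1 q hq0) (hint' q hq0)] at this
  refine cauchy_map_iff_exists_tendsto.1 (Metric.cauchy_iff.2 ⟨inferInstance, fun e he => ?_⟩)
  -- Two points are compared through `Φ r`, each within `2 / (k + 1) < e / 2`.
  obtain ⟨k, hk⟩ := exists_nat_one_div_lt (show 0 < e / 4 by positivity)
  obtain ⟨r, hr0, hr⟩ := hbound k
  refine ⟨Φ '' Set.Ioo 0 r, image_mem_map (Ioo_mem_nhdsGT hr0), ?_⟩
  rintro _ ⟨x, hx, rfl⟩ _ ⟨y, hy, rfl⟩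
  have h3 := hr x hx.1 hx.2
  have h4 := hr y hy.1 hy.2
  have h5 := dist_triangle_right (Φ x) (Φ y) (Φ r)
  rw [dist_eq_norm, dist_eq_norm] at h5
  rw [dist_eq_norm] at h5 ⊢
  linarith

end IsPoissonRandomMeasure


/-! ### Integrability of `h k` and `(β - h) k` under the intensity -/

section CompensatorIntegrability

variable {X : Type*} [MeasurableSpace X] {ν : Measure X} {b : X → ℝ} {h : ℝ → ℝ}
  {H : Type*} [NormedAddCommGroup H] [NormedSpace ℝ H]

theorem memLp_two_compensator_smul (hb : Measurable b) (hh : IsCompensator h) {k : X → H}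
    (hk : StronglyMeasurable k)
    (hk2 : ∫⁻ p, ‖k p‖ₑ ^ 2 * ENNReal.ofReal (min 1 (b p ^ 2)) ∂ν ≠ ∞) :
    MemLp (fun p => h (b p) • k p) 2 ν := by
  obtain ⟨C, hC0, hC, -⟩ := hh.exists_bound
  refine ⟨((hh.measurable.comp hb).stronglyMeasurable.smul hk).aestronglyMeasurable, ?_⟩
  rw [eLpNorm_two_eq_lintegral]
  refine ENNReal.rpow_lt_top_of_nonneg (by norm_num) (ne_of_lt ?_)
  calc ∫⁻ p, ‖h (b p) • k p‖ₑ ^ 2 ∂ν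
      ≤ ∫⁻ p, ENNReal.ofReal C * (‖k p‖ₑ ^ 2 * ENNReal.ofReal (min 1 (b p ^ 2))) ∂ν := by
        refine lintegral_mono fun p => ?_
        rw [enorm_smul, mul_pow, mul_left_comm, mul_comm]
        refine mul_le_mul_right ?_ _
        rw [← ENNReal.ofReal_mul hC0, ← ofReal_norm, ← ENNReal.ofReal_pow (norm_nonneg _),
          Real.norm_eq_abs, sq_abs]
        exact ENNReal.ofReal_le_ofReal (hC _)
    _ = ENNReal.ofReal C * ∫⁻ p, ‖k p‖ₑ ^ 2 * ENNReal.ofReal (min 1 (b p ^ 2)) ∂ν :=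
        lintegral_const_mul _ (by
          have := hk.enorm
          fun_prop)
    _ < ∞ := ENNReal.mul_lt_top ENNReal.ofReal_lt_top hk2.lt_top

theorem integrableOn_bigJumps_of_memLp_two {E : Type*} [NormedAddCommGroup E] (hb : Measurable b)
    (hν1 : ∫⁻ p, ENNReal.ofReal (min 1 (b p ^ 2)) ∂ν ≠ ∞) {g : X → E} (hg : MemLp g 2 ν)
    {ε : ℝ} (hε : 0 < ε) : IntegrableOn g (bigJumps b ε) ν := by
  have : IsFiniteMeasure (ν.restrict (bigJumps b ε)) :=
    ⟨by simpa using measure_bigJumps_lt_top hb hν1 hε⟩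
  exact (hg.restrict _).integrable (by norm_num)

/-- For `|b| ≤ 1` the factor `|b - h b|` is of order `1 ∧ b²`. Only the square of `‖k‖` is
integrable against this, but `‖k‖ ≤ 1 + ‖k‖²` and `1 ∧ b²` is itself integrable. -/
theorem integrableOn_sub_compensator_smul (hb : Measurable b) (hh : IsCompensator h) {k : X → H}
    (hk : StronglyMeasurable k)
    (hν1 : ∫⁻ p, ENNReal.ofReal (min 1 (b p ^ 2)) ∂ν ≠ ∞)
    (hk2 : ∫⁻ p, ‖k p‖ₑ ^ 2 * ENNReal.ofReal (min 1 (b p ^ 2)) ∂ν ≠ ∞) :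
    IntegrableOn (fun p => (b p - h (b p)) • k p) (bigJumps b 1)ᶜ ν := by
  obtain ⟨C, hC0, -, hC⟩ := hh.exists_bound
  refine ⟨((hb.sub (hh.measurable.comp hb)).stronglyMeasurable.smul hk).aestronglyMeasurable, ?_⟩
  have hke := hk.enorm
  rw [HasFiniteIntegral]
  calc ∫⁻ p in (bigJumps b 1)ᶜ, ‖(b p - h (b p)) • k p‖ₑ ∂ν
      ≤ ∫⁻ p in (bigJumps b 1)ᶜ, ENNReal.ofReal C *
          (ENNReal.ofReal (min 1 (b p ^ 2)) +
            ‖k p‖ₑ ^ 2 * ENNReal.ofReal (min 1 (b p ^ 2))) ∂ν := by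
        refine setLIntegral_mono (by fun_prop) fun p hp => ?_
        have hp1 : |b p| ≤ 1 := by simpa [bigJumps] using hp
        rw [enorm_smul]
        have h1 : ‖b p - h (b p)‖ₑ ≤ ENNReal.ofReal C * ENNReal.ofReal (min 1 (b p ^ 2)) := by
          rw [← ENNReal.ofReal_mul hC0, ← ofReal_norm, Real.norm_eq_abs]
          exact ENNReal.ofReal_le_ofReal (hC _ hp1)
        have h2 : ‖k p‖ₑ ≤ 1 + ‖k p‖ₑ ^ 2 := by
          rcases le_total ‖k p‖ₑ 1 with h | h
          · exact h.trans le_self_add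
          · calc ‖k p‖ₑ = ‖k p‖ₑ * 1 := (mul_one _).symm
              _ ≤ ‖k p‖ₑ * ‖k p‖ₑ := by gcongr
              _ = ‖k p‖ₑ ^ 2 := (pow_two _).symm
              _ ≤ _ := le_add_self
        calc _ ≤ ENNReal.ofReal C * ENNReal.ofReal (min 1 (b p ^ 2)) * (1 + ‖k p‖ₑ ^ 2) := by
              gcongr
          _ = _ := by ring
    _ ≤ ∫⁻ p, ENNReal.ofReal C * (ENNReal.ofReal (min 1 (b p ^ 2)) +
            ‖k p‖ₑ ^ 2 * ENNReal.ofReal (min 1 (b p ^ 2))) ∂ν := setLIntegral_le_lintegral _ _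
    _ < ∞ := by
        rw [lintegral_const_mul _ (by fun_prop), lintegral_add_left (by fun_prop)]
        exact ENNReal.mul_lt_top ENNReal.ofReal_lt_top
          (ENNReal.add_lt_top.2 ⟨hν1.lt_top, hk2.lt_top⟩)

end CompensatorIntegrability

namespace IsPoissonRandomMeasure

variable {S X : Type*} [MeasurableSpace S] [MeasurableSpace X]
  {P : Measure S} {ν : Measure X} {N : S → Measure X} {b : X → ℝ} {h : ℝ → ℝ}

theorem aestronglyMeasurable_integral [SigmaFinite ν] (hN : IsPoissonRandomMeasure P ν N)
    {ψ : X → ℝ} (hψ : AEStronglyMeasurable ψ ν) :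
    AEStronglyMeasurable (fun θ => ∫ p, ψ p ∂(N θ)) P := by
  refine (hN.stronglyMeasurable_integral hψ.stronglyMeasurable_mk).aestronglyMeasurable.congr ?_
  filter_upwards [hN.ae_ae hψ.ae_eq_mk] with θ hθ
  exact (integral_congr_ae hθ).symm

variable [IsProbabilityMeasure P]

theorem ae_forall_integrableOn_bigJumps (hN : IsPoissonRandomMeasure P ν N) (hb : Measurable b)
    (hν0 : ν {p | b p = 0} = 0) (hν1 : ∫⁻ p, ENNReal.ofReal (min 1 (b p ^ 2)) ∂ν ≠ ∞)
    {E : Type*} [NormedAddCommGroup E] {g : X → E} (hg : StronglyMeasurable g) :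
    ∀ᵐ θ ∂P, ∀ ε, 0 < ε → IntegrableOn g (bigJumps b ε) (N θ) := by
  have := sigmaFinite_of_bigJumps hb hν0 hν1
  have hint : ∀ᵐ θ ∂P, ∀ n : ℕ, IntegrableOn g (bigJumps b (1 / ((n : ℝ) + 1))) (N θ) :=
    ae_all_iff.2 fun n => hN.ae_integrableOn_of_measure_ne_top hg (measurableSet_bigJumps hb _)
      (measure_bigJumps_lt_top hb hν1 (by positivity)).ne
  filter_upwards [hint] with θ hθ ε hε
  obtain ⟨n, hn⟩ := exists_nat_one_div_lt hε
  exact (hθ n).mono_set (bigJumps_anti hn.le)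

/-! ### Convergence of the truncated integrals in a Hilbert space -/

section Hilbert

variable {H : Type*} [NormedAddCommGroup H] [InnerProductSpace ℝ H]

/-- Jumps of size at most `1` are handled by the intensity. For larger ones the integrand need not
be `ν`-integrable, and finiteness of the number of points is used instead. -/
theorem ae_integrable_sub_compensator_smul (hN : IsPoissonRandomMeasure P ν N)
    (hb : Measurable b) (hh : IsCompensator h)
    (hν0 : ν {p | b p = 0} = 0) (hν1 : ∫⁻ p, ENNReal.ofReal (min 1 (b p ^ 2)) ∂ν ≠ ∞)
    {k : X → H} (hk : StronglyMeasurable k)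
    (hk2 : ∫⁻ p, ‖k p‖ₑ ^ 2 * ENNReal.ofReal (min 1 (b p ^ 2)) ∂ν ≠ ∞) :
    ∀ᵐ θ ∂P, Integrable (fun p => (b p - h (b p)) • k p) (N θ) := by
  have := sigmaFinite_of_bigJumps hb hν0 hν1
  have hJ := measurableSet_bigJumps hb 1
  have hsm := (hb.sub (hh.measurable.comp hb)).stronglyMeasurable.smul hk
  filter_upwards [hN.ae_forall_integrableOn_bigJumps hb hν0 hν1 hsm,
    hN.ae_integrable ((integrable_indicator_iff hJ.compl).2
      (integrableOn_sub_compensator_smul hb hh hk hν1 hk2))] with θ h1 h2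
  rw [integrable_indicator_iff hJ.compl] at h2
  rw [← integrableOn_univ, ← Set.union_compl_self (bigJumps b 1)]
  exact (h1 1 one_pos).union h2

/-- The truncated field with values in a Hilbert space. -/
noncomputable def _root_.LevyField.truncInt (ν : Measure X) (b : X → ℝ) (h : ℝ → ℝ) (k : X → H)
    (ε : ℝ) (m : Measure X) : H :=
  (∫ p in bigJumps b ε, b p • k p ∂m) - ∫ p in bigJumps b ε, h (b p) • k p ∂ν

theorem _root_.LevyField.truncInt_eq {k : X → H} {ε : ℝ} {m : Measure X}
    (h1 : Integrable (fun p => (b p - h (b p)) • k p) m)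
    (h2 : IntegrableOn (fun p => h (b p) • k p) (bigJumps b ε) m) :
    truncInt ν b h k ε m = (∫ p in bigJumps b ε, (b p - h (b p)) • k p ∂m) +
      compInt ν m (fun p => h (b p) • k p) (bigJumps b ε) := by
  have h3 : ∫ p in bigJumps b ε, b p • k p ∂m =
      (∫ p in bigJumps b ε, (b p - h (b p)) • k p ∂m) +
        ∫ p in bigJumps b ε, h (b p) • k p ∂m := by
    rw [← integral_add h1.integrableOn h2]
    simp_rw [← add_smul, sub_add_cancel]
  rw [truncInt, compInt, h3, add_sub_assoc]

/-- Almost surely the truncated integrals `∫_{|b| > ε} b k dN - ∫_{|b| > ε} h(b) k dν` converge as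
`ε → 0`, together with the compensated integrals they contain. -/
theorem ae_exists_tendsto_truncInt [CompleteSpace H] (hN : IsPoissonRandomMeasure P ν N)
    (hb : Measurable b) (hh : IsCompensator h)
    (hν0 : ν {p | b p = 0} = 0) (hν1 : ∫⁻ p, ENNReal.ofReal (min 1 (b p ^ 2)) ∂ν ≠ ∞)
    {k : X → H} (hk : StronglyMeasurable k)
    (hk2 : ∫⁻ p, ‖k p‖ₑ ^ 2 * ENNReal.ofReal (min 1 (b p ^ 2)) ∂ν ≠ ∞) :
    ∀ᵐ θ ∂P, ∃ z, Tendsto (fun ε => compInt ν (N θ) (fun p => h (b p) • k p) (bigJumps b ε))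
        (𝓝[>] 0) (𝓝 z) ∧
      Tendsto (fun ε => truncInt ν b h k ε (N θ)) (𝓝[>] 0)
        (𝓝 ((∫ p, (b p - h (b p)) • k p ∂(N θ)) + z)) := by
  have := sigmaFinite_of_bigJumps hb hν0 hν1
  have hsm := (hh.measurable.comp hb).stronglyMeasurable.smul hk
  have hL2 := memLp_two_compensator_smul hb hh hk hk2
  -- The sets `bigJumps b ε` exhaust only the points with nonzero mark.
  have hz : ∀ᵐ θ ∂P, N θ {p | b p = 0} = 0 := by
    have hq : ∀ᵐ p ∂ν, b p ≠ 0 := by rw [ae_iff]; simpa using hν0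
    filter_upwards [hN.ae_ae hq] with θ hθ
    rw [ae_iff] at hθ
    simpa using hθ
  filter_upwards [hN.ae_exists_tendsto_compInt hsm hL2 hb hν0
      (fun ε hε => integrableOn_bigJumps_of_memLp_two hb hν1 hL2 hε),
    hN.ae_forall_integrableOn_bigJumps hb hν0 hν1 hsm,
    hN.ae_integrable_sub_compensator_smul hb hh hν0 hν1 hk hk2, hz] with θ ⟨z, h1⟩ h2 h3 h4
  refine ⟨z, h1, ?_⟩
  refine ((tendsto_setIntegral_bigJumps_zero hb h4 h3).add h1).congr' ?_
  filter_upwards [self_mem_nhdsWithin] with ε hε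
  exact (truncInt_eq h3 (h2 ε hε)).symm

end Hilbert

/-! ### Versions of the scalar compensated integral -/

section Scalar

theorem eLpNorm_compensated_sub_le [SigmaFinite ν] (hN : IsPoissonRandomMeasure P ν N)
    {ψ ψ' : X → ℝ} (h1 : Integrable ψ ν) (h2 : MemLp ψ 2 ν) (h1' : Integrable ψ' ν)
    (h2' : MemLp ψ' 2 ν) :
    eLpNorm (fun θ => ((∫ p, ψ p ∂(N θ)) - ∫ p, ψ p ∂ν) -
      ((∫ p, ψ' p ∂(N θ)) - ∫ p, ψ' p ∂ν)) 2 P ≤ eLpNorm (fun p => ψ p - ψ' p) 2 ν := by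
  refine le_trans (eLpNorm_congr_ae ?_).le
    (hN.eLpNorm_compensated_le (h1.sub h1') (h2.sub h2'))
  filter_upwards [hN.ae_integrable h1, hN.ae_integrable h1'] with θ hθ hθ'
  rw [integral_sub h1 h1', integral_sub hθ hθ']
  ring

/-- Two versions of the same compensated integral agree almost surely. -/
theorem ae_eq_of_isCompensatedIntegral [SigmaFinite ν] (hN : IsPoissonRandomMeasure P ν N)
    {ψ : X → ℝ} {Z Z' : S → ℝ} (hZ : IsCompensatedIntegral P ν N ψ Z)
    (hZ' : IsCompensatedIntegral P ν N ψ Z') : Z =ᵐ[P] Z' := by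
  obtain ⟨hψ, hZm, u, hu, hu1, hu2⟩ := hZ
  obtain ⟨-, hZm', v, hv, hv1, hv2⟩ := hZ'
  have hmu : ∀ n, AEStronglyMeasurable (fun θ => (∫ p, u n p ∂(N θ)) - ∫ p, u n p ∂ν) P :=
    fun n => (hN.aestronglyMeasurable_integral (hu n).1.1).sub aestronglyMeasurable_const
  have hmv : ∀ n, AEStronglyMeasurable (fun θ => (∫ p, v n p ∂(N θ)) - ∫ p, v n p ∂ν) P :=
    fun n => (hN.aestronglyMeasurable_integral (hv n).1.1).sub aestronglyMeasurable_const
  have hle : ∀ n, eLpNorm (Z - Z') 2 P ≤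
      eLpNorm (fun θ => (∫ p, u n p ∂(N θ)) - (∫ p, u n p ∂ν) - Z θ) 2 P +
      ((eLpNorm (fun p => u n p - ψ p) 2 ν + eLpNorm (fun p => v n p - ψ p) 2 ν) +
      eLpNorm (fun θ => (∫ p, v n p ∂(N θ)) - (∫ p, v n p ∂ν) - Z' θ) 2 P) := by
    intro n
    set U := fun θ => (∫ p, u n p ∂(N θ)) - ∫ p, u n p ∂ν with hU
    set V := fun θ => (∫ p, v n p ∂(N θ)) - ∫ p, v n p ∂ν with hV
    -- The middle difference is itself a compensated integral, bounded by the `L²(ν)` distance of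
    -- the two approximating integrands.
    have e1 : Z - Z' = (Z - U) + ((U - V) + (V - Z')) := by abel
    have e2 : (fun p => u n p - v n p) = (fun p => u n p - ψ p) - fun p => v n p - ψ p := by
      ext p; simp
    calc eLpNorm (Z - Z') 2 P ≤ eLpNorm (Z - U) 2 P + eLpNorm ((U - V) + (V - Z')) 2 P := by
          conv_lhs => rw [e1]
          exact eLpNorm_add_le (hZm.1.sub (hmu n))
            (((hmu n).sub (hmv n)).add ((hmv n).sub hZm'.1)) (by norm_num)
      _ ≤ eLpNorm (U - Z) 2 P + (eLpNorm (U - V) 2 P + eLpNorm (V - Z') 2 P) := by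
          rw [eLpNorm_sub_comm]
          gcongr
          exact eLpNorm_add_le ((hmu n).sub (hmv n)) ((hmv n).sub hZm'.1) (by norm_num)
      _ ≤ _ := by
          refine add_le_add le_rfl (add_le_add ?_ le_rfl)
          refine (hN.eLpNorm_compensated_sub_le (hu n).1 (hu n).2 (hv n).1 (hv n).2).trans ?_
          rw [e2]
          exact eLpNorm_sub_le ((hu n).1.1.sub hψ.1) ((hv n).1.1.sub hψ.1) (by norm_num)
  have hlim := hu2.add ((hu1.add hv1).add hv2)
  simp only [add_zero] at hlim
  have h0 : eLpNorm (Z - Z') 2 P = 0 := le_antisymm (ge_of_tendsto' hlim hle) zero_le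
  rw [eLpNorm_eq_zero_iff (hZm.1.sub hZm'.1) (by norm_num)] at h0
  filter_upwards [h0] with θ hθ
  simpa [sub_eq_zero] using hθ

/-- An almost sure limit of the compensated integrals over `|b| > 1 / (n + 1)` is a version of the
compensated integral. -/
theorem isCompensatedIntegral_of_tendsto (hN : IsPoissonRandomMeasure P ν N) (hb : Measurable b)
    (hν0 : ν {p | b p = 0} = 0) (hν1 : ∫⁻ p, ENNReal.ofReal (min 1 (b p ^ 2)) ∂ν ≠ ∞)
    {ψ : X → ℝ} (hψm : StronglyMeasurable ψ) (hψ : MemLp ψ 2 ν) {Z : S → ℝ}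
    (hZ : ∀ᵐ θ ∂P, Tendsto (fun n : ℕ => compInt ν (N θ) ψ (bigJumps b (1 / ((n : ℝ) + 1)))) atTop
      (𝓝 (Z θ))) : IsCompensatedIntegral P ν N ψ Z := by
  have := sigmaFinite_of_bigJumps hb hν0 hν1
  set J : ℕ → Set X := fun n => bigJumps b (1 / ((n : ℝ) + 1)) with hJdef
  have hJ : ∀ n, MeasurableSet (J n) := fun n => measurableSet_bigJumps hb _
  have hJmono : Monotone J := fun i j hij =>
    bigJumps_anti (one_div_le_one_div_of_le (by positivity) (by simpa using hij))
  set ψn : ℕ → X → ℝ := fun n => (J n).indicator ψ with hψn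
  have hi : ∀ n, Integrable (ψn n) ν := fun n => (integrable_indicator_iff (hJ n)).2
    (integrableOn_bigJumps_of_memLp_two hb hν1 hψ (by positivity))
  have hi2 : ∀ n, MemLp (ψn n) 2 ν := fun n => hψ.indicator (hJ n)
  have hcomp : ∀ n θ, compInt ν (N θ) ψ (J n) = (∫ p, ψn n p ∂(N θ)) - ∫ p, ψn n p ∂ν := by
    intro n θ
    rw [compInt, integral_indicator (hJ n), integral_indicator (hJ n)]
  have hm : ∀ n, AEStronglyMeasurable (fun θ => (∫ p, ψn n p ∂(N θ)) - ∫ p, ψn n p ∂ν) P :=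
    fun n => (hN.aestronglyMeasurable_integral (hi n).1).sub aestronglyMeasurable_const
  replace hZ : ∀ᵐ θ ∂P, Tendsto (fun n => (∫ p, ψn n p ∂(N θ)) - ∫ p, ψn n p ∂ν) atTop
      (𝓝 (Z θ)) := hZ.mono fun θ hθ => hθ.congr fun n => hcomp n θ
  have hZm : AEStronglyMeasurable Z P := aestronglyMeasurable_of_tendsto_ae atTop hm hZ
  have hconv : Tendsto (fun n => eLpNorm (fun p => ψn n p - ψ p) 2 ν) atTop (𝓝 0) := by
    have h1 := tendsto_setLIntegral_compl_bigJumps hb hν0 (g := fun p => ‖ψ p‖ₑ ^ 2)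
      (hψm.enorm.pow_const 2) (by
        have := hψ.2
        rw [eLpNorm_two_eq_lintegral] at this
        exact ((ENNReal.rpow_lt_top_iff_of_pos (by norm_num)).1 this).ne)
    have h2 : ∀ n, eLpNorm (fun p => ψn n p - ψ p) 2 ν =
        (∫⁻ p in (J n)ᶜ, ‖ψ p‖ₑ ^ 2 ∂ν) ^ (1 / 2 : ℝ) := by
      intro n
      rw [eLpNorm_two_eq_lintegral, ← lintegral_indicator (hJ n).compl]
      congr 2
      ext p
      by_cases hp : p ∈ J n
      · simp [hψn, hp]
      · simp [hψn, hp]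
    simp_rw [h2]
    have h3 := (ENNReal.continuous_rpow_const (y := (1 / 2 : ℝ))).tendsto 0
    rw [ENNReal.zero_rpow_of_pos (by norm_num)] at h3
    exact h3.comp h1
  -- Fatou in `m` with `n` fixed; for `m ≥ n`, `ψn n - ψn m` is dominated pointwise by `ψn n - ψ`.
  -- This upgrades almost sure convergence to `L²(P)`.
  have hle : ∀ n, eLpNorm (fun θ => (∫ p, ψn n p ∂(N θ)) - (∫ p, ψn n p ∂ν) - Z θ) 2 P ≤
      eLpNorm (fun p => ψn n p - ψ p) 2 ν := by
    intro n
    have hf := Lp.eLpNorm_lim_le_liminf_eLpNorm (p := 2) (μ := P)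
      (f := fun m θ => ((∫ p, ψn n p ∂(N θ)) - ∫ p, ψn n p ∂ν) -
        ((∫ p, ψn m p ∂(N θ)) - ∫ p, ψn m p ∂ν)) (fun m => (hm n).sub (hm m))
      (fun θ => (∫ p, ψn n p ∂(N θ)) - (∫ p, ψn n p ∂ν) - Z θ) (by
        filter_upwards [hZ] with θ hθ
        exact tendsto_const_nhds.sub hθ)
    refine hf.trans ?_
    rw [← (tendsto_const_nhds (x := eLpNorm (fun p => ψn n p - ψ p) 2 ν)
      (f := (atTop : Filter ℕ))).liminf_eq]
    refine liminf_le_liminf ?_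
    filter_upwards [eventually_ge_atTop n] with m hnm
    refine (hN.eLpNorm_compensated_sub_le (hi n) (hi2 n) (hi m) (hi2 m)).trans ?_
    refine eLpNorm_mono fun p => ?_
    by_cases hp : p ∈ J n
    · simp [hψn, hp, hJmono hnm hp]
    · by_cases hp' : p ∈ J m <;> simp [hψn, hp, hp']
  refine ⟨hψ, ?_, ψn, fun n => ⟨hi n, hi2 n⟩, hconv,
    tendsto_of_tendsto_of_tendsto_of_le_of_le tendsto_const_nhds hconv (fun _ => zero_le) hle⟩
  -- `Z` is square integrable as the approximant at `n = 0` minus its error.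
  have ha : MemLp (fun θ => (∫ p, ψn 0 p ∂(N θ)) - (∫ p, ψn 0 p ∂ν)) 2 P :=
    ⟨hm 0, (hN.eLpNorm_compensated_le (hi 0) (hi2 0)).trans_lt (hi2 0).2⟩
  have hb' : MemLp (fun θ => (∫ p, ψn 0 p ∂(N θ)) - (∫ p, ψn 0 p ∂ν) - Z θ) 2 P :=
    ⟨(hm 0).sub hZm, (hle 0).trans_lt ((hi2 0).sub hψ).2⟩
  refine (ha.sub hb').ae_eq (ae_of_all _ fun θ => ?_)
  simp

end Scalar

end IsPoissonRandomMeasure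


/-! ### Weighted composition operators on `L²` -/

section WeightedComp

variable {Y : Type*} [MeasurableSpace Y] {μ : Measure Y} {T : Y → Y} {c : ℝ≥0∞} {m : Y → ℂ} {K : ℝ}

theorem quasiMeasurePreserving_of_map_eq_smul (hT : Measurable T) (hc : μ.map T = c • μ) :
    Measure.QuasiMeasurePreserving T μ μ :=
  ⟨hT, by rw [hc]; exact Measure.smul_absolutelyContinuous⟩

theorem eLpNorm_comp_of_map_eq_smul (hT : Measurable T) (hc : μ.map T = c • μ) {F : Y → ℂ}
    (hF : AEStronglyMeasurable F μ) :
    eLpNorm (fun y => F (T y)) 2 μ = c ^ (1 / (2 : ℝ≥0∞)).toReal * eLpNorm F 2 μ := by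
  have h := eLpNorm_map_measure (p := 2) (μ := μ) (f := T) (g := F)
    (by rw [hc]; exact hF.mono_ac Measure.smul_absolutelyContinuous) hT.aemeasurable
  rw [hc, eLpNorm_smul_measure_of_ne_top (by simp)] at h
  exact h.symm

theorem memLp_weightedComp (hT : Measurable T) (hc : μ.map T = c • μ) (hc' : c ≠ ∞)
    (hm : Measurable m) (hK : ∀ y, ‖m y‖ ≤ K) {F : Y → ℂ} (hF : MemLp F 2 μ) :
    MemLp (fun y => m y * F (T y)) 2 μ := by
  have hq := hF.1.comp_quasiMeasurePreserving (quasiMeasurePreserving_of_map_eq_smul hT hc)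
  have h1 : MemLp (fun y => F (T y)) 2 μ := by
    refine ⟨hq, ?_⟩
    rw [eLpNorm_comp_of_map_eq_smul hT hc hF.1]
    exact ENNReal.mul_lt_top (ENNReal.rpow_lt_top_of_nonneg (by simp) hc') hF.2
  refine h1.of_le_mul (c := K) (hm.aestronglyMeasurable.mul hq) (ae_of_all _ fun y => ?_)
  rw [norm_mul]
  exact mul_le_mul_of_nonneg_right (hK y) (norm_nonneg _)

/-- The operator `F ↦ m · (F ∘ T)` on `L²(μ)`, for a bounded weight `m` and a map `T` that scales
the measure by a finite constant. -/
noncomputable def weightedComp (hT : Measurable T) (hc : μ.map T = c • μ) (hc' : c ≠ ∞)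
    (hm : Measurable m) (hK : ∀ y, ‖m y‖ ≤ K) : Lp ℂ 2 μ →L[ℂ] Lp ℂ 2 μ :=
  LinearMap.mkContinuousOfExistsBound
    { toFun := fun F => (memLp_weightedComp hT hc hc' hm hK (Lp.memLp F)).toLp _
      map_add' := fun F F' => by
        ext1
        have hq := quasiMeasurePreserving_of_map_eq_smul hT hc
        filter_upwards [MemLp.coeFn_toLp (memLp_weightedComp hT hc hc' hm hK (Lp.memLp (F + F'))),
          MemLp.coeFn_toLp (memLp_weightedComp hT hc hc' hm hK (Lp.memLp F)),
          MemLp.coeFn_toLp (memLp_weightedComp hT hc hc' hm hK (Lp.memLp F')),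
          hq.ae (Lp.coeFn_add F F'),
          Lp.coeFn_add ((memLp_weightedComp hT hc hc' hm hK (Lp.memLp F)).toLp _)
            ((memLp_weightedComp hT hc hc' hm hK (Lp.memLp F')).toLp _)] with y h1 h2 h3 h4 h5
        rw [h1, h5, Pi.add_apply, h2, h3, h4, Pi.add_apply, mul_add]
      map_smul' := fun a F => by
        ext1
        have hq := quasiMeasurePreserving_of_map_eq_smul hT hc
        filter_upwards [MemLp.coeFn_toLp (memLp_weightedComp hT hc hc' hm hK (Lp.memLp (a • F))),
          MemLp.coeFn_toLp (memLp_weightedComp hT hc hc' hm hK (Lp.memLp F)),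
          hq.ae (Lp.coeFn_smul a F),
          Lp.coeFn_smul a ((memLp_weightedComp hT hc hc' hm hK (Lp.memLp F)).toLp _)]
          with y h1 h2 h3 h4
        rw [RingHom.id_apply, h1, h4, Pi.smul_apply, h2, h3, Pi.smul_apply, smul_eq_mul,
          smul_eq_mul]
        ring }
    ⟨K * (c ^ (1 / (2 : ℝ≥0∞)).toReal).toReal, fun F => by
      have hq := (Lp.aestronglyMeasurable F).comp_quasiMeasurePreserving
        (quasiMeasurePreserving_of_map_eq_smul hT hc)
      have h1 : eLpNorm (fun y => m y * F (T y)) 2 μ ≤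
          ENNReal.ofReal K * eLpNorm (fun y => F (T y)) 2 μ :=
        eLpNorm_le_mul_eLpNorm_of_ae_le_mul (ae_of_all _ fun y => by
          rw [norm_mul]
          exact mul_le_mul_of_nonneg_right (hK y) (norm_nonneg _)) 2
      rw [eLpNorm_comp_of_map_eq_smul hT hc (Lp.aestronglyMeasurable F)] at h1
      have hfin : ENNReal.ofReal K * (c ^ (1 / (2 : ℝ≥0∞)).toReal * eLpNorm F 2 μ) ≠ ∞ :=
        ENNReal.mul_ne_top ENNReal.ofReal_ne_top (ENNReal.mul_ne_top
          (ENNReal.rpow_lt_top_of_nonneg (by simp) hc').ne (Lp.memLp F).2.ne)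
      have h2 := ENNReal.toReal_mono hfin h1
      by_cases hY : Nonempty Y
      · have hK0 : 0 ≤ K := (norm_nonneg _).trans (hK hY.some)
        rw [ENNReal.toReal_mul, ENNReal.toReal_mul, ENNReal.toReal_ofReal hK0, ← mul_assoc] at h2
        rw [LinearMap.coe_mk, AddHom.coe_mk, Lp.norm_toLp, Lp.norm_def]
        exact h2
      · have : IsEmpty Y := not_nonempty_iff.1 hY
        have hμ : μ = 0 := Measure.eq_zero_of_isEmpty μ
        subst hμ
        simp [Lp.norm_def]⟩

theorem coeFn_weightedComp (hT : Measurable T) (hc : μ.map T = c • μ) (hc' : c ≠ ∞)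
    (hm : Measurable m) (hK : ∀ y, ‖m y‖ ≤ K) (F : Lp ℂ 2 μ) :
    weightedComp hT hc hc' hm hK F =ᵐ[μ] fun y => m y * F (T y) :=
  MemLp.coeFn_toLp (memLp_weightedComp hT hc hc' hm hK (Lp.memLp F))

end WeightedComp

/-! ### The Fourier transform under affine changes of variables -/

section FourierAffine

open SchwartzMap

variable {V : Type*} [NormedAddCommGroup V] [InnerProductSpace ℝ V]

/-- The factor `|det A|⁻¹ exp (-2πi χ·η)` that a change of variables adds to a Fourier transform. -/
noncomputable def fourierFactor (A : V ≃L[ℝ] V) (χ η : V) : ℂ :=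
  (|LinearMap.det (A.symm : V →ₗ[ℝ] V)| : ℝ) *
    Complex.exp ((-2 * Real.pi * inner ℝ χ η : ℝ) * Complex.I)

theorem norm_fourierFactor (A : V ≃L[ℝ] V) (χ η : V) :
    ‖fourierFactor A χ η‖ = |LinearMap.det (A.symm : V →ₗ[ℝ] V)| := by
  rw [fourierFactor, norm_mul, Complex.norm_exp_ofReal_mul_I, mul_one, Complex.norm_real,
    Real.norm_eq_abs, abs_abs]

variable [MeasurableSpace V] [BorelSpace V]

theorem measurable_affine (A : V ≃L[ℝ] V) (χ : V) : Measurable fun x : V => A (x - χ) :=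
  A.continuous.measurable.comp (measurable_sub_const χ)

variable [FiniteDimensional ℝ V]

theorem map_continuousLinearEquiv_volume (A : V ≃L[ℝ] V) :
    (volume : Measure V).map A =
      ENNReal.ofReal |LinearMap.det (A.symm : V →ₗ[ℝ] V)| • volume := by
  have hdet : LinearMap.det (A : V →ₗ[ℝ] V) ≠ 0 := (LinearEquiv.isUnit_det' A.toLinearEquiv).ne_zero
  have h := Measure.map_linearMap_addHaar_eq_smul_addHaar (volume : Measure V) hdet
  have h2 : LinearMap.det (A.symm : V →ₗ[ℝ] V) = (LinearMap.det (A : V →ₗ[ℝ] V))⁻¹ := by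
    refine eq_inv_of_mul_eq_one_left ?_
    rw [← LinearMap.det_comp]
    have : (A.symm : V →ₗ[ℝ] V) ∘ₗ (A : V →ₗ[ℝ] V) = LinearMap.id := by ext; simp
    rw [this, LinearMap.det_id]
  rw [h2]
  exact h

theorem map_affine_volume (A : V ≃L[ℝ] V) (χ : V) :
    (volume : Measure V).map (fun x => A (x - χ)) =
      ENNReal.ofReal |LinearMap.det (A.symm : V →ₗ[ℝ] V)| • volume := by
  rw [← map_continuousLinearEquiv_volume A]
  have h := Measure.map_map (μ := (volume : Measure V)) (g := A) (f := fun x => x - χ)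
    A.continuous.measurable (measurable_sub_const χ)
  rw [(measurePreserving_sub_right volume χ).map_eq] at h
  exact h.symm

theorem measurable_fourierFactor (A : V ≃L[ℝ] V) (χ : V) : Measurable (fourierFactor A χ) := by
  unfold fourierFactor
  fun_prop

/-- Substitute `y = A (x - χ)`; `B` is the adjoint of `A⁻¹`. No integrability of `f` is needed,
since the substitution also preserves the default value of the integral. -/
theorem fourier_comp_affine_apply (f : V → ℂ) (A B : V ≃L[ℝ] V)
    (hAB : ∀ y η, inner ℝ (A.symm y) η = inner ℝ y (B η)) (χ η : V) :
    𝓕 (fun x => f (A (x - χ))) η = fourierFactor A χ η * 𝓕 f (B η) := by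
  rw [Real.fourier_eq', Real.fourier_eq']
  set g : V → ℂ := fun y =>
    Complex.exp ((↑(-2 * Real.pi * inner ℝ (A.symm y + χ) η) * Complex.I)) • f y with hg
  have h1 : (fun x => Complex.exp ((↑(-2 * Real.pi * inner ℝ x η) * Complex.I)) •
      f (A (x - χ))) = fun x => g (A (x - χ)) := by
    ext x; simp [hg]
  have hme : MeasurableEmbedding (fun x : V => A (x - χ)) :=
    (A.toHomeomorph.measurableEmbedding).comp
      ((Homeomorph.subRight χ).measurableEmbedding)
  rw [h1, ← hme.integral_map, map_affine_volume, integral_smul_measure,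
    ENNReal.toReal_ofReal (abs_nonneg _), fourierFactor, mul_assoc, ← integral_const_mul,
    Complex.real_smul]
  congr 1
  refine integral_congr_ae (ae_of_all _ fun y => ?_)
  simp only [hg, smul_eq_mul]
  rw [← mul_assoc, ← Complex.exp_add, inner_add_left, hAB]
  congr 2
  push_cast
  ring

/-- The Fourier transform of `x ↦ F (A (x - χ))` for `F ∈ L²`. -/
theorem fourier_toLp_comp_affine (F : Lp (α := V) ℂ 2 volume) (A B : V ≃L[ℝ] V)
    (hAB : ∀ y η, inner ℝ (A.symm y) η = inner ℝ y (B η)) (χ : V)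
    (hF : MemLp (fun x => F (A (x - χ))) 2 volume) :
    (𝓕 (hF.toLp _) : Lp (α := V) ℂ 2 volume) =ᵐ[volume]
      fun η => fourierFactor A χ η * (𝓕 F : Lp (α := V) ℂ 2 volume) (B η) := by
  set U : Lp (α := V) ℂ 2 volume →L[ℂ] Lp (α := V) ℂ 2 volume :=
    weightedComp (m := fun _ => 1) (K := 1) (measurable_affine A χ) (map_affine_volume A χ)
      ENNReal.ofReal_ne_top measurable_const (by simp) with hU
  set W : Lp (α := V) ℂ 2 volume →L[ℂ] Lp (α := V) ℂ 2 volume :=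
    weightedComp B.continuous.measurable (map_continuousLinearEquiv_volume B)
      ENNReal.ofReal_ne_top (measurable_fourierFactor A χ)
      (fun η => (norm_fourierFactor A χ η).le) with hW
  have hUF : ∀ F : Lp (α := V) ℂ 2 volume, U F =ᵐ[volume] fun x => F (A (x - χ)) := fun F =>
    (coeFn_weightedComp _ _ _ _ _ F).trans (ae_of_all _ fun x => one_mul _)
  have hWF : ∀ F : Lp (α := V) ℂ 2 volume,
      W F =ᵐ[volume] fun η => fourierFactor A χ η * F (B η) := fun F =>
    coeFn_weightedComp _ _ _ _ _ F
  -- Both sides are continuous in `F`, and on the dense set of Schwartz functions the pointwise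
  -- formula applies.
  have key : ∀ F : Lp (α := V) ℂ 2 volume, 𝓕 (U F) = W (𝓕 F) := by
    intro F
    have hc : Continuous fun F : Lp (α := V) ℂ 2 volume => (𝓕 F : Lp (α := V) ℂ 2 volume) :=
      (Lp.fourierTransformₗᵢ V ℂ).continuous
    refine congrFun (DenseRange.equalizer
      (SchwartzMap.denseRange_toLpCLM (E := V) (F := ℂ) (p := 2) ENNReal.ofNat_ne_top)
      (hc.comp U.continuous) (W.continuous.comp hc) ?_) F
    ext1 f
    simp only [Function.comp_apply, SchwartzMap.toLpCLM_apply]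
    set f' : 𝓢(V, ℂ) := (SchwartzMap.compCLMOfContinuousLinearEquiv ℂ A f).compSubConstCLM ℂ χ
      with hf'
    have hqA := quasiMeasurePreserving_of_map_eq_smul (measurable_affine A χ)
      (map_affine_volume A χ)
    have hqB := quasiMeasurePreserving_of_map_eq_smul B.continuous.measurable
      (map_continuousLinearEquiv_volume B)
    have h1 : U (f.toLp 2) = f'.toLp 2 := by
      ext1
      filter_upwards [hUF (f.toLp 2), f'.coeFn_toLp 2 volume, hqA.ae (f.coeFn_toLp 2 volume)]
        with x h1 h2 h3
      rw [h1, h2, h3]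
      rfl
    rw [h1, SchwartzMap.toLp_fourier_eq, SchwartzMap.toLp_fourier_eq]
    ext1
    filter_upwards [(𝓕 f').coeFn_toLp 2 volume, hWF ((𝓕 f).toLp 2),
      hqB.ae ((𝓕 f).coeFn_toLp 2 volume)] with η h1 h2 h3
    rw [h1, h2, h3, SchwartzMap.fourier_coe, SchwartzMap.fourier_coe]
    exact fourier_comp_affine_apply f A B hAB χ η
  have h2 : hF.toLp _ = U F := by
    ext1
    exact hF.coeFn_toLp.trans (hUF F).symm
  rw [h2, key F]
  exact hWF _

end FourierAffine


/-! ### The Sobolev norm as an `L²` norm in frequency -/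

section SobolevWeight

variable {d : ℕ}

/-- The square root of the Sobolev weight, in the frequency variable of Mathlib's transform. -/
noncomputable def weight (s : ℝ) (η : EuclideanSpace ℝ (Fin d)) : ℝ :=
  (1 + (2 * Real.pi * ‖η‖) ^ 2) ^ (s / 2)

theorem weight_pos (s : ℝ) (η : EuclideanSpace ℝ (Fin d)) : 0 < weight s η := by
  unfold weight; positivity

theorem one_le_weight {s : ℝ} (hs : 0 ≤ s) (η : EuclideanSpace ℝ (Fin d)) : 1 ≤ weight s η :=
  Real.one_le_rpow (by nlinarith [sq_nonneg (2 * Real.pi * ‖η‖)]) (by positivity)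

theorem measurable_weight (s : ℝ) : Measurable (weight (d := d) s) := by
  unfold weight; fun_prop

theorem weight_sq (s : ℝ) (η : EuclideanSpace ℝ (Fin d)) :
    weight s η ^ 2 = (1 + (2 * Real.pi * ‖η‖) ^ 2) ^ s := by
  rw [weight, ← Real.rpow_natCast, ← Real.rpow_mul (by positivity)]
  congr 1
  push_cast
  ring

theorem lintegral_comp_smul_volume (g : EuclideanSpace ℝ (Fin d) → ℝ≥0∞) {r : ℝ} (hr : r ≠ 0) :
    ∫⁻ ξ, g (r • ξ) = ENNReal.ofReal |(r ^ d)⁻¹| * ∫⁻ η, g η := by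
  have he : MeasurableEmbedding fun ξ : EuclideanSpace ℝ (Fin d) => r • ξ :=
    (Homeomorph.smulOfNeZero r hr).measurableEmbedding
  rw [← he.lintegral_map, Measure.map_addHaar_smul volume hr, lintegral_smul_measure]
  simp

/-- With `ξ = -2π η` the Jacobian `(2π)ᵈ` cancels the normalising constant exactly, and `|ξ| = 2π
|η|` turns the weight into `weight s η ^ 2`. -/
theorem sobolevNorm_eq_eLpNorm (s : ℝ) {f : EuclideanSpace ℝ (Fin d) → ℝ}
    (hf : MemLp (fun x => (f x : ℂ)) 2 volume) :
    sobolevNorm s f = eLpNorm (fun η => (weight s η : ℂ) *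
      (𝓕 (hf.toLp _) : Lp (α := EuclideanSpace ℝ (Fin d)) ℂ 2 volume) η) 2 volume := by
  rw [sobolevNorm, dif_pos hf, eLpNorm_two_eq_lintegral]
  congr 1
  set F := (𝓕 (hf.toLp _) : Lp (α := EuclideanSpace ℝ (Fin d)) ℂ 2 volume) with hF
  have hpi : (0 : ℝ) < 2 * Real.pi := by positivity
  have hr : -(2 * Real.pi)⁻¹ ≠ 0 := neg_ne_zero.2 (inv_ne_zero hpi.ne')
  have h := lintegral_comp_smul_volume (fun η => ‖(weight s η : ℂ) * F η‖ₑ ^ 2) hr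
  have hint : ∀ ξ : EuclideanSpace ℝ (Fin d),
      ENNReal.ofReal ((1 + ‖ξ‖ ^ 2) ^ s * ‖fourierL2 (hf.toLp _) ξ‖ ^ 2) =
        ‖(weight s (-(2 * Real.pi)⁻¹ • ξ) : ℂ) * F (-(2 * Real.pi)⁻¹ • ξ)‖ₑ ^ 2 := by
    intro ξ
    rw [← ofReal_norm, ← ENNReal.ofReal_pow (norm_nonneg _), norm_mul, mul_pow, Complex.norm_real,
      Real.norm_of_nonneg (weight_pos _ _).le, weight_sq, norm_smul, norm_neg, norm_inv,
      Real.norm_of_nonneg hpi.le, mul_inv_cancel_left₀ hpi.ne']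
    rfl
  simp_rw [hint]
  rw [h, ← mul_assoc, ← ENNReal.ofReal_mul (by positivity)]
  have hc : ((2 * Real.pi) ^ d)⁻¹ * |((-(2 * Real.pi)⁻¹) ^ d)⁻¹| = 1 := by
    rw [abs_inv, abs_pow, abs_neg, abs_inv, abs_of_pos hpi, inv_pow, inv_inv]
    exact inv_mul_cancel₀ (by positivity)
  rw [hc, ENNReal.ofReal_one, one_mul]

/-- Division by the weight on `L²`. -/
noncomputable def divWeight {s : ℝ} (hs : 0 ≤ s) :
    Lp (α := EuclideanSpace ℝ (Fin d)) ℂ 2 volume →L[ℂ]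
      Lp (α := EuclideanSpace ℝ (Fin d)) ℂ 2 volume :=
  weightedComp (T := id) (c := 1) (m := fun η => ((weight s η)⁻¹ : ℂ)) (K := 1) measurable_id
    (by simp) ENNReal.one_ne_top
    ((Complex.measurable_ofReal.comp (measurable_weight s)).inv)
    (fun η => by
      rw [norm_inv, Complex.norm_real, Real.norm_of_nonneg (weight_pos _ _).le]
      exact inv_le_one_of_one_le₀ (one_le_weight hs η))

theorem coeFn_divWeight {s : ℝ} (hs : 0 ≤ s)
    (u : Lp (α := EuclideanSpace ℝ (Fin d)) ℂ 2 volume) :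
    divWeight hs u =ᵐ[volume] fun η => ((weight s η)⁻¹ : ℂ) * u η :=
  coeFn_weightedComp _ _ _ _ _ u

/-- The isometry from `L²` in frequency onto the Sobolev space, as a map into `L²`. -/
noncomputable def sobolevEmb {s : ℝ} (hs : 0 ≤ s) :
    Lp (α := EuclideanSpace ℝ (Fin d)) ℂ 2 volume →L[ℂ]
      Lp (α := EuclideanSpace ℝ (Fin d)) ℂ 2 volume :=
  ((Lp.fourierTransformₗᵢ (EuclideanSpace ℝ (Fin d)) ℂ).symm.toContinuousLinearEquiv :
    Lp (α := EuclideanSpace ℝ (Fin d)) ℂ 2 volume →L[ℂ] _) ∘L divWeight hs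

theorem fourier_sobolevEmb {s : ℝ} (hs : 0 ≤ s)
    (u : Lp (α := EuclideanSpace ℝ (Fin d)) ℂ 2 volume) :
    (𝓕 (sobolevEmb hs u) : Lp (α := EuclideanSpace ℝ (Fin d)) ℂ 2 volume) = divWeight hs u :=
  (Lp.fourierTransformₗᵢ (EuclideanSpace ℝ (Fin d)) ℂ).apply_symm_apply _

theorem weight_mul_fourier_sobolevEmb {s : ℝ} (hs : 0 ≤ s)
    (u : Lp (α := EuclideanSpace ℝ (Fin d)) ℂ 2 volume) :
    (fun η => (weight s η : ℂ) *
      (𝓕 (sobolevEmb hs u) : Lp (α := EuclideanSpace ℝ (Fin d)) ℂ 2 volume) η) =ᵐ[volume] u := by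
  rw [fourier_sobolevEmb]
  filter_upwards [coeFn_divWeight hs u] with η hη
  rw [hη, mul_inv_cancel_left₀]
  exact_mod_cast (weight_pos s η).ne'

theorem sobolevEmb_eq_of_ae {s : ℝ} (hs : 0 ≤ s)
    {u F : Lp (α := EuclideanSpace ℝ (Fin d)) ℂ 2 volume}
    (h : u =ᵐ[volume] fun η => (weight s η : ℂ) *
      (𝓕 F : Lp (α := EuclideanSpace ℝ (Fin d)) ℂ 2 volume) η) : sobolevEmb hs u = F := by
  have h2 := (weight_mul_fourier_sobolevEmb hs u).trans h
  have h3 : (𝓕 (sobolevEmb hs u) : Lp (α := EuclideanSpace ℝ (Fin d)) ℂ 2 volume) = 𝓕 F := by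
    ext1
    filter_upwards [h2] with η hη
    exact mul_left_cancel₀ (by exact_mod_cast (weight_pos s η).ne') hη
  exact (Lp.fourierTransformₗᵢ (EuclideanSpace ℝ (Fin d)) ℂ).injective h3

/-- The weight cancels the division made in `sobolevEmb`. Through this identity, convergence in `H`
becomes convergence in the Sobolev norm. -/
theorem sobolevNorm_eq_of_ae {s : ℝ} (hs : 0 ≤ s) {f : EuclideanSpace ℝ (Fin d) → ℝ}
    {u : Lp (α := EuclideanSpace ℝ (Fin d)) ℂ 2 volume}
    (h : (fun x => (f x : ℂ)) =ᵐ[volume] sobolevEmb hs u) : sobolevNorm s f = ‖u‖ₑ := by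
  have hf : MemLp (fun x => (f x : ℂ)) 2 volume := (Lp.memLp (sobolevEmb hs u)).ae_eq h.symm
  have h2 : hf.toLp _ = sobolevEmb hs u := by
    ext1
    exact hf.coeFn_toLp.trans h
  rw [sobolevNorm_eq_eLpNorm s hf, h2, eLpNorm_congr_ae (weight_mul_fourier_sobolevEmb hs u),
    Lp.enorm_def]

end SobolevWeight

/-! ### Measurable maps into `L²` -/

section MeasurableToLp

/-- By second countability every open set is a countable union of balls, whose preimages are
sublevel sets of distances. -/
theorem measurable_of_measurable_edist {Y E : Type*} [MeasurableSpace Y] [PseudoEMetricSpace E]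
    [SecondCountableTopology E] [MeasurableSpace E] [BorelSpace E] {f : Y → E}
    (hf : ∀ c, Measurable fun y => edist (f y) c) : Measurable f := by
  refine measurable_of_isOpen fun U hU => ?_
  choose! r hr hrU using EMetric.isOpen_iff.1 hU
  obtain ⟨T, hTU, hT, hTe⟩ := TopologicalSpace.isOpen_biUnion_countable U
    (fun x => Metric.eball x (r x)) fun x _ => Metric.isOpen_eball
  have hUe : U = ⋃ x ∈ T, Metric.eball x (r x) := by
    rw [hTe]
    exact Set.Subset.antisymm
      (fun x hx => Set.mem_iUnion₂.2 ⟨x, hx, Metric.mem_eball_self (hr x hx)⟩)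
      (Set.iUnion₂_subset hrU)
  rw [hUe, Set.preimage_iUnion₂]
  exact MeasurableSet.biUnion hT fun x _ => hf x measurableSet_Iio

/-- A jointly measurable family of square integrable functions is a measurable map into `L²`. -/
theorem stronglyMeasurable_toLp {Y V : Type*} [MeasurableSpace Y] [MeasurableSpace V]
    [MeasurableSpace.CountablyGenerated V] {μ : Measure V}
    [SigmaFinite μ] {F : Y → V → ℂ} (hF : Measurable (Function.uncurry F))
    (hF2 : ∀ y, MemLp (F y) 2 μ) : StronglyMeasurable fun y => (hF2 y).toLp (F y) := by
  have : Fact ((2 : ℝ≥0∞) ≠ ∞) := ⟨by simp⟩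
  borelize ↥(Lp ℂ 2 μ)
  refine (measurable_of_measurable_edist fun c => ?_).stronglyMeasurable
  have h1 : ∀ y, edist ((hF2 y).toLp (F y)) c = (∫⁻ x, ‖F y x - c x‖ₑ ^ 2 ∂μ) ^ (1 / 2 : ℝ) := by
    intro y
    conv_lhs => rw [← Lp.toLp_coeFn c (Lp.memLp c)]
    rw [Lp.edist_toLp_toLp, eLpNorm_two_eq_lintegral]
    rfl
  simp_rw [h1]
  refine Measurable.pow_const (Measurable.lintegral_prod_right' (f := fun z : Y × V =>
    ‖F z.1 z.2 - c z.2‖ₑ ^ 2) ?_) _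
  have := (Lp.stronglyMeasurable c).measurable
  exact ((hF.sub (this.comp measurable_snd)).enorm).pow_const 2

end MeasurableToLp


/-! ### Matrices as operators and measurability in their entries -/

section Matrices

variable {d : ℕ}

/-- The linear equivalence given by a nonsingular matrix. -/
noncomputable def matrixEquiv (M : Matrix (Fin d) (Fin d) ℝ) (hM : M.det ≠ 0) :
    EuclideanSpace ℝ (Fin d) ≃L[ℝ] EuclideanSpace ℝ (Fin d) :=
  ContinuousLinearEquiv.equivOfInverse (Matrix.toEuclideanCLM (𝕜 := ℝ) M)
    (Matrix.toEuclideanCLM (𝕜 := ℝ) M⁻¹)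
    (fun x => by
      rw [← mul_apply_eq_comp, ← map_mul,
        Matrix.nonsing_inv_mul M (isUnit_iff_ne_zero.2 hM), map_one,
        one_apply_eq_self])
    (fun x => by
      rw [← mul_apply_eq_comp, ← map_mul,
        Matrix.mul_nonsing_inv M (isUnit_iff_ne_zero.2 hM), map_one,
        one_apply_eq_self])

theorem matrixEquiv_apply (M : Matrix (Fin d) (Fin d) ℝ) (hM : M.det ≠ 0)
    (x : EuclideanSpace ℝ (Fin d)) :
    matrixEquiv M hM x = Matrix.toEuclideanCLM (𝕜 := ℝ) M x := rfl

theorem matrixEquiv_symm_apply (M : Matrix (Fin d) (Fin d) ℝ) (hM : M.det ≠ 0)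
    (x : EuclideanSpace ℝ (Fin d)) :
    (matrixEquiv M hM).symm x = Matrix.toEuclideanCLM (𝕜 := ℝ) M⁻¹ x := rfl

theorem det_toEuclideanCLM (M : Matrix (Fin d) (Fin d) ℝ) :
    LinearMap.det (Matrix.toEuclideanCLM (𝕜 := ℝ) M :
      EuclideanSpace ℝ (Fin d) →ₗ[ℝ] EuclideanSpace ℝ (Fin d)) = M.det := by
  rw [Matrix.coe_toEuclideanCLM_eq_toEuclideanLin, Matrix.toEuclideanLin, Matrix.toLpLin_eq_toLin,
    LinearMap.det_toLin]

theorem det_matrixEquiv_symm (M : Matrix (Fin d) (Fin d) ℝ) (hM : M.det ≠ 0) :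
    LinearMap.det ((matrixEquiv M hM).symm :
      EuclideanSpace ℝ (Fin d) →ₗ[ℝ] EuclideanSpace ℝ (Fin d)) = M.det⁻¹ := by
  have : ((matrixEquiv M hM).symm : EuclideanSpace ℝ (Fin d) →ₗ[ℝ] EuclideanSpace ℝ (Fin d)) =
      (Matrix.toEuclideanCLM (𝕜 := ℝ) M⁻¹ : EuclideanSpace ℝ (Fin d) →ₗ[ℝ] _) := rfl
  rw [this, det_toEuclideanCLM, Matrix.det_nonsing_inv, Ring.inverse_eq_inv']

theorem inner_toEuclideanCLM_transpose (M : Matrix (Fin d) (Fin d) ℝ)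
    (x y : EuclideanSpace ℝ (Fin d)) :
    inner ℝ (Matrix.toEuclideanCLM (𝕜 := ℝ) M.transpose x) y =
      inner ℝ x (Matrix.toEuclideanCLM (𝕜 := ℝ) M y) := by
  rw [real_inner_comm, Matrix.inner_toEuclideanCLM, Matrix.inner_toEuclideanCLM,
    Matrix.dotProduct_mulVec, Matrix.vecMul_transpose, dotProduct_comm]

theorem measurable_entry (i j : Fin d) : Measurable fun L : Scale d => L.1 i j :=
  measurable_pi_iff.1 (measurable_pi_iff.1
    (comap_measurable fun (L : Scale d) (i j : Fin d) => L.1 i j) i) j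

section Entries

variable {Y : Type*} [MeasurableSpace Y] {M : Y → Matrix (Fin d) (Fin d) ℝ}

theorem measurable_toEuclideanCLM_apply (hM : ∀ i j, Measurable fun y => M y i j)
    {v : Y → EuclideanSpace ℝ (Fin d)} (hv : Measurable v) :
    Measurable fun y => Matrix.toEuclideanCLM (𝕜 := ℝ) (M y) (v y) := by
  have h : ∀ y, Matrix.toEuclideanCLM (𝕜 := ℝ) (M y) (v y) =
      WithLp.toLp 2 fun i => ∑ j, M y i j * (v y).ofLp j := fun y =>
    Matrix.toEuclideanCLM_toLp (𝕜 := ℝ) (M y) (v y).ofLp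
  simp_rw [h]
  refine (WithLp.measurable_toLp 2 _).comp (measurable_pi_lambda _ fun i =>
    Finset.measurable_fun_sum _ fun j _ => (hM i j).mul ?_)
  exact (measurable_pi_apply j).comp ((WithLp.measurable_ofLp 2 _).comp hv)

theorem measurable_det (hM : ∀ i j, Measurable fun y => M y i j) :
    Measurable fun y => (M y).det := by
  simp_rw [Matrix.det_apply]
  exact Finset.measurable_fun_sum _ fun σ _ =>
    (Finset.measurable_fun_prod _ fun i _ => hM _ _).const_smul _

/-- Cramer's rule: an entry of the inverse is a quotient of determinants. -/
theorem measurable_inv_entry (hM : ∀ i j, Measurable fun y => M y i j) (i j : Fin d) :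
    Measurable fun y => (M y)⁻¹ i j := by
  have h : ∀ y, (M y)⁻¹ i j = (M y).det⁻¹ * ((M y).updateRow j (Pi.single i 1)).det := fun y => by
    rw [Matrix.inv_def, Ring.inverse_eq_inv', ← Matrix.adjugate_apply]; rfl
  simp_rw [h]
  refine (measurable_det hM).inv.mul (measurable_det fun a b => ?_)
  simp_rw [Matrix.updateRow_apply]
  by_cases hab : a = j
  · simp [hab]
  · simpa [hab] using hM a b

end Entries

theorem measurable_kernel {G : EuclideanSpace ℝ (Fin d) → ℝ} (hG : Measurable G) :
    Measurable fun z : EuclideanSpace ℝ (Fin d) × Param d => kernel G z.1 z.2 := by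
  refine hG.comp (measurable_toEuclideanCLM_apply (fun i j => ?_) ?_)
  · exact (measurable_entry j i).comp (measurable_snd.comp measurable_snd)
  · exact measurable_fst.sub (measurable_fst.comp measurable_snd)

end Matrices

/-! ### The kernels in frequency space -/

section KernelTransform

variable {d : ℕ}

theorem det_transpose_ne_zero (L : Scale d) : L.1.transpose.det ≠ 0 := by
  rw [Matrix.det_transpose]; exact L.2

theorem det_inv_ne_zero (L : Scale d) : (L.1⁻¹).det ≠ 0 := by
  rw [Matrix.det_nonsing_inv, Ring.inverse_eq_inv']; exact inv_ne_zero L.2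

/-- The weighted Fourier transform of `φ(·, ω)`, in terms of the transform `g` of `G`. -/
noncomputable def kernelFreq (s : ℝ) (g : EuclideanSpace ℝ (Fin d) → ℂ) (ω : Param d)
    (η : EuclideanSpace ℝ (Fin d)) : ℂ :=
  weight s η * (fourierFactor (matrixEquiv ω.2.1.transpose (det_transpose_ne_zero ω.2)) ω.1 η *
    g (Matrix.toEuclideanCLM (𝕜 := ℝ) ω.2.1⁻¹ η))

theorem measurable_kernelFreq (s : ℝ) {g : EuclideanSpace ℝ (Fin d) → ℂ} (hg : Measurable g) :
    Measurable (Function.uncurry (kernelFreq s g)) := by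
  have hentry : ∀ i j, Measurable fun z : Param d × EuclideanSpace ℝ (Fin d) => z.1.2.1 i j :=
    fun i j => (measurable_entry i j).comp (measurable_snd.comp measurable_fst)
  have h1 : Measurable fun z : Param d × EuclideanSpace ℝ (Fin d) => (weight s z.2 : ℂ) :=
    Complex.measurable_ofReal.comp ((measurable_weight s).comp measurable_snd)
  have h2 : Measurable fun z : Param d × EuclideanSpace ℝ (Fin d) =>
      g (Matrix.toEuclideanCLM (𝕜 := ℝ) z.1.2.1⁻¹ z.2) :=
    hg.comp (measurable_toEuclideanCLM_apply (measurable_inv_entry hentry) measurable_snd)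
  have hdet : Measurable fun z : Param d × EuclideanSpace ℝ (Fin d) => z.1.2.1.det :=
    measurable_det hentry
  have hχ : Measurable fun z : Param d × EuclideanSpace ℝ (Fin d) => z.1.1 :=
    measurable_fst.comp measurable_fst
  have h3 : Measurable fun z : Param d × EuclideanSpace ℝ (Fin d) =>
      fourierFactor (matrixEquiv z.1.2.1.transpose (det_transpose_ne_zero z.1.2)) z.1.1 z.2 := by
    simp_rw [fourierFactor, det_matrixEquiv_symm, Matrix.det_transpose]
    have hin : Measurable fun z : Param d × EuclideanSpace ℝ (Fin d) => inner ℝ z.1.1 z.2 :=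
      hχ.inner measurable_snd
    fun_prop
  exact h1.mul (h3.mul h2)

/-- With `t = (2π |ζ|)²`, `1 + ρ² t ≤ max 1 ρ² * (1 + t)`, and `(max 1 ρ²) ^ s ≤ 1 + ρ ^ (2 s)`. -/
theorem weight_toEuclideanCLM_sq_le {s : ℝ} (hs : 0 ≤ s) (L : Matrix (Fin d) (Fin d) ℝ)
    (ζ : EuclideanSpace ℝ (Fin d)) :
    weight s (Matrix.toEuclideanCLM (𝕜 := ℝ) L ζ) ^ 2 ≤ (1 + rho L ^ (2 * s)) * weight s ζ ^ 2 := by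
  rw [weight_sq, weight_sq]
  have hρ : 0 ≤ rho L := norm_nonneg _
  have h1 : ‖Matrix.toEuclideanCLM (𝕜 := ℝ) L ζ‖ ≤ rho L * ‖ζ‖ :=
    ContinuousLinearMap.le_opNorm _ _
  set t := (2 * Real.pi * ‖ζ‖) ^ 2 with ht
  have ht0 : 0 ≤ t := sq_nonneg _
  have h2 : (2 * Real.pi * ‖Matrix.toEuclideanCLM (𝕜 := ℝ) L ζ‖) ^ 2 ≤ rho L ^ 2 * t := by
    rw [ht, ← mul_pow]
    refine pow_le_pow_left₀ (by positivity) ?_ 2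
    calc 2 * Real.pi * ‖Matrix.toEuclideanCLM (𝕜 := ℝ) L ζ‖
        ≤ 2 * Real.pi * (rho L * ‖ζ‖) := by gcongr
      _ = rho L * (2 * Real.pi * ‖ζ‖) := by ring
  have h3 : rho L ^ (2 * s) = (rho L ^ 2) ^ s := by
    rw [← Real.rpow_natCast, ← Real.rpow_mul hρ]; norm_num
  rw [h3]
  rcases le_total (rho L ^ 2) 1 with h | h
  · calc (1 + (2 * Real.pi * ‖Matrix.toEuclideanCLM (𝕜 := ℝ) L ζ‖) ^ 2) ^ s
        ≤ (1 + t) ^ s := by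
          refine Real.rpow_le_rpow (by positivity) ?_ hs
          nlinarith
      _ = 1 * (1 + t) ^ s := (one_mul _).symm
      _ ≤ _ := by
          gcongr
          have : 0 ≤ (rho L ^ 2) ^ s := by positivity
          linarith
  · calc (1 + (2 * Real.pi * ‖Matrix.toEuclideanCLM (𝕜 := ℝ) L ζ‖) ^ 2) ^ s
        ≤ (rho L ^ 2 * (1 + t)) ^ s := by
          refine Real.rpow_le_rpow (by positivity) ?_ hs
          nlinarith
      _ = (rho L ^ 2) ^ s * (1 + t) ^ s := Real.mul_rpow (by positivity) (by positivity)
      _ ≤ _ := by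
          gcongr
          linarith

/-- Substitute `η = Λ ζ`. The squared Fourier factor contributes `|Λ|⁻²` and the Jacobian `|Λ|`,
which leaves `|Λ|⁻¹`. -/
theorem lintegral_enorm_kernelFreq_sq_le {s : ℝ} (hs : 0 ≤ s)
    (g : EuclideanSpace ℝ (Fin d) → ℂ) (ω : Param d) :
    ∫⁻ η, ‖kernelFreq s g ω η‖ₑ ^ 2 ≤
      ENNReal.ofReal (|ω.2.1.det|⁻¹ * (1 + rho ω.2.1 ^ (2 * s))) *
        ∫⁻ η, ‖(weight s η : ℂ) * g η‖ₑ ^ 2 := by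
  set L := ω.2.1 with hL
  have hL0 : L.det ≠ 0 := ω.2.2
  have hinv : ∀ η, Matrix.toEuclideanCLM (𝕜 := ℝ) L (Matrix.toEuclideanCLM (𝕜 := ℝ) L⁻¹ η) = η :=
    fun η => (matrixEquiv L hL0).apply_symm_apply η
  set q : EuclideanSpace ℝ (Fin d) → ℝ≥0∞ := fun ζ =>
    ENNReal.ofReal (|L.det|⁻¹ ^ 2 * (weight s (Matrix.toEuclideanCLM (𝕜 := ℝ) L ζ) ^ 2 *
      ‖g ζ‖ ^ 2)) with hq
  have h1 : ∀ η, ‖kernelFreq s g ω η‖ₑ ^ 2 = q (matrixEquiv L⁻¹ (det_inv_ne_zero ω.2) η) := by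
    intro η
    rw [hq, matrixEquiv_apply]
    simp only [hinv]
    rw [kernelFreq, ← ofReal_norm, ← ENNReal.ofReal_pow (norm_nonneg _), norm_mul, norm_mul,
      norm_fourierFactor, det_matrixEquiv_symm, Matrix.det_transpose, Complex.norm_real,
      Real.norm_of_nonneg (weight_pos _ _).le, abs_inv]
    congr 1
    ring
  simp_rw [h1]
  have hqB := map_continuousLinearEquiv_volume (matrixEquiv L⁻¹ (det_inv_ne_zero ω.2))
  rw [det_matrixEquiv_symm, Matrix.det_nonsing_inv, Ring.inverse_eq_inv', inv_inv] at hqB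
  have hlm := ((matrixEquiv L⁻¹
      (det_inv_ne_zero ω.2)).toHomeomorph.measurableEmbedding).lintegral_map (μ := volume) q
  refine (hlm.symm.trans (congrArg (fun m => ∫⁻ ζ, q ζ ∂m) hqB)).trans_le ?_
  rw [lintegral_smul_measure, ← lintegral_const_mul' _ _ ENNReal.ofReal_ne_top, smul_eq_mul,
    ← lintegral_const_mul' _ _ ENNReal.ofReal_ne_top]
  refine lintegral_mono fun ζ => ?_
  rw [hq, ← ofReal_norm, ← ENNReal.ofReal_pow (norm_nonneg _)]
  simp only
  rw [← ENNReal.ofReal_mul (abs_nonneg _), ← ENNReal.ofReal_mul (by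
    have : 0 ≤ rho L := norm_nonneg _
    positivity)]
  refine ENNReal.ofReal_le_ofReal ?_
  rw [norm_mul, Complex.norm_real, Real.norm_of_nonneg (weight_pos _ _).le, mul_pow]
  have hdet : 0 < |L.det| := abs_pos.2 hL0
  have h3 := weight_toEuclideanCLM_sq_le hs L ζ
  calc |L.det| * (|L.det|⁻¹ ^ 2 * (weight s (Matrix.toEuclideanCLM (𝕜 := ℝ) L ζ) ^ 2 *
        ‖g ζ‖ ^ 2))
      = |L.det|⁻¹ * weight s (Matrix.toEuclideanCLM (𝕜 := ℝ) L ζ) ^ 2 * ‖g ζ‖ ^ 2 := by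
        field_simp
    _ ≤ |L.det|⁻¹ * ((1 + rho L ^ (2 * s)) * weight s ζ ^ 2) * ‖g ζ‖ ^ 2 := by gcongr
    _ = _ := by ring

theorem MemW.memLp {s : ℝ} {G : EuclideanSpace ℝ (Fin d) → ℝ} (hG : MemW s G) :
    MemLp (fun x => (G x : ℂ)) 2 volume := by
  by_contra h
  rw [MemW, sobolevNorm, dif_neg h] at hG
  exact lt_irrefl _ hG

/-- The kernels `φ(·, ω)`, in the Hilbert space that parametrises the Sobolev space. -/
theorem exists_kernel_hilbert {s : ℝ} (hs : 0 ≤ s) {G : EuclideanSpace ℝ (Fin d) → ℝ}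
    (hG : MemW s G) :
    ∃ k : Param d → Lp (α := EuclideanSpace ℝ (Fin d)) ℂ 2 volume, StronglyMeasurable k ∧
      (∀ ω, sobolevEmb hs (k ω) =ᵐ[volume] fun x => (kernel G x ω : ℂ)) ∧
      ∃ C : ℝ≥0∞, C ≠ ∞ ∧ ∀ ω, ‖k ω‖ₑ ^ 2 ≤
        ENNReal.ofReal (|ω.2.1.det|⁻¹ * (1 + rho ω.2.1 ^ (2 * s))) * C := by
  have hG2 := hG.memLp
  set Gc := hG2.toLp _ with hGc
  set g := (𝓕 Gc : Lp (α := EuclideanSpace ℝ (Fin d)) ℂ 2 volume) with hg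
  have hgm : Measurable g := (Lp.stronglyMeasurable g).measurable
  set C := ∫⁻ η, ‖(weight s η : ℂ) * g η‖ₑ ^ 2 with hC
  have hCfin : C ≠ ∞ := by
    have h := hG
    rw [MemW, sobolevNorm_eq_eLpNorm s hG2, eLpNorm_two_eq_lintegral] at h
    exact ((ENNReal.rpow_lt_top_iff_of_pos (by norm_num)).1 h).ne
  have hmem : ∀ ω, MemLp (kernelFreq s g ω) 2 volume := fun ω => by
    refine ⟨((measurable_kernelFreq s hgm).comp measurable_prodMk_left).aestronglyMeasurable, ?_⟩
    rw [eLpNorm_two_eq_lintegral]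
    exact ENNReal.rpow_lt_top_of_nonneg (by norm_num)
      ((lintegral_enorm_kernelFreq_sq_le hs g ω).trans_lt
        (ENNReal.mul_lt_top ENNReal.ofReal_lt_top hCfin.lt_top)).ne
  refine ⟨fun ω => (hmem ω).toLp _, stronglyMeasurable_toLp (measurable_kernelFreq s hgm) hmem,
    fun ω => ?_, C, hCfin, fun ω => ?_⟩
  · set A := matrixEquiv ω.2.1.transpose (det_transpose_ne_zero ω.2) with hA
    set B := matrixEquiv ω.2.1⁻¹ (det_inv_ne_zero ω.2) with hB
    -- The kernel composes `G` with `Λ'`, and the adjoint of `(Λ')⁻¹` is `Λ⁻¹`.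
    have hAB : ∀ y η, inner ℝ (A.symm y) η = inner ℝ y (B η) := by
      intro y η
      rw [hA, hB, matrixEquiv_symm_apply, matrixEquiv_apply, ← Matrix.transpose_nonsing_inv,
        inner_toEuclideanCLM_transpose]
    have hqA := quasiMeasurePreserving_of_map_eq_smul (measurable_affine A ω.1)
      (map_affine_volume A ω.1)
    have hGA : (fun x => Gc (A (x - ω.1))) =ᵐ[volume] fun x => (kernel G x ω : ℂ) := by
      filter_upwards [hqA.ae hG2.coeFn_toLp] with x hx
      rw [hx]
      rfl
    have hF : MemLp (fun x => Gc (A (x - ω.1))) 2 volume := by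
      have := memLp_weightedComp (m := fun _ => 1) (K := 1) (measurable_affine A ω.1)
        (map_affine_volume A ω.1) ENNReal.ofReal_ne_top measurable_const (by simp) (Lp.memLp Gc)
      simpa using this
    have hJ : sobolevEmb hs ((hmem ω).toLp _) = hF.toLp _ := by
      refine sobolevEmb_eq_of_ae hs ?_
      filter_upwards [(hmem ω).coeFn_toLp, fourier_toLp_comp_affine Gc A B hAB ω.1 hF]
        with η h1 h2
      rw [h1, h2]
      rfl
    rw [hJ]
    exact hF.coeFn_toLp.trans hGA
  · rw [Lp.enorm_toLp, eLpNorm_two_eq_lintegral, ← ENNReal.rpow_natCast, ← ENNReal.rpow_mul]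
    rw [show (1 / 2 : ℝ) * (2 : ℕ) = 1 by norm_num, ENNReal.rpow_one]
    exact lintegral_enorm_kernelFreq_sq_le hs g ω

end KernelTransform


/-! ### Bochner integrals in `L²` and pointwise integrals -/

section FieldIntegral

variable {X V : Type*} [MeasurableSpace X] [MeasurableSpace V] {m : Measure X}
  {μ : Measure V} [SigmaFinite μ]

/-- Cauchy–Schwarz on `B` bounds the `L¹` norm of `F p` by `‖K p‖ μ(B)^(1/2)`, which is integrable
in `p`. -/
theorem integrable_uncurry_restrict_of_toLp {K : X → Lp ℂ 2 μ} (hK : Integrable K m)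
    {F : X → V → ℂ} (hF : StronglyMeasurable (Function.uncurry F)) (hKF : ∀ p, K p =ᵐ[μ] F p)
    {B : Set V} (hμB : μ B < ∞) :
    Integrable (Function.uncurry F) (m.prod (μ.restrict B)) := by
  have : IsFiniteMeasure (μ.restrict B) := ⟨by simpa using hμB⟩
  have hL2 : ∀ p, MemLp (F p) 2 (μ.restrict B) := fun p =>
    ((Lp.memLp (K p)).ae_eq (hKF p)).restrict B
  refine (integrable_prod_iff hF.aestronglyMeasurable).2
    ⟨ae_of_all _ fun p => (hL2 p).integrable (by norm_num), ?_⟩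
  refine (hK.norm.mul_const (μ.real B ^ (1 / 2 : ℝ))).mono'
    hF.norm.integral_prod_right.aestronglyMeasurable (ae_of_all _ fun p => ?_)
  rw [Real.norm_of_nonneg (integral_nonneg fun _ => norm_nonneg _)]
  have h1 := eLpNorm_le_eLpNorm_mul_rpow_measure_univ (p := 1) (q := 2) (by norm_num) (hL2 p).1
  have h2 : eLpNorm (F p) 2 (μ.restrict B) ≤ ‖K p‖ₑ := by
    rw [Lp.enorm_def, eLpNorm_congr_ae (hKF p)]
    exact eLpNorm_mono_measure _ Measure.restrict_le_self
  have h3 : eLpNorm (F p) 1 (μ.restrict B) ≤ ‖K p‖ₑ * μ B ^ (1 / 2 : ℝ) := by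
    refine h1.trans ?_
    rw [Measure.restrict_apply_univ]
    norm_num
    gcongr
  rw [eLpNorm_one_eq_lintegral_enorm] at h3
  simp only [Function.uncurry_apply_pair]
  rw [integral_norm_eq_lintegral_enorm (hL2 p).1]
  refine (ENNReal.toReal_mono ?_ h3).trans (le_of_eq ?_)
  · exact ENNReal.mul_ne_top enorm_ne_top (ENNReal.rpow_ne_top_of_nonneg (by norm_num) hμB.ne)
  · rw [ENNReal.toReal_mul, toReal_enorm, ← ENNReal.toReal_rpow]; rfl

/-- A Bochner integral in `L²` is computed pointwise. -/
theorem coeFn_integral_ae_eq [SFinite m] {K : X → Lp ℂ 2 μ} (hK : Integrable K m)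
    {F : X → V → ℂ} (hF : StronglyMeasurable (Function.uncurry F)) (hKF : ∀ p, K p =ᵐ[μ] F p) :
    (∫ p, K p ∂m : Lp ℂ 2 μ) =ᵐ[μ] fun x => ∫ p, F p x ∂m := by
  refine ae_eq_of_forall_setIntegral_eq_of_sigmaFinite (fun B _ hμB => ?_) (fun B _ hμB => ?_)
    fun B hB hμB => ?_
  · have : IsFiniteMeasure (μ.restrict B) := ⟨by simpa using hμB⟩
    exact ((Lp.memLp _).restrict B).integrable (by norm_num)
  · exact (integrable_uncurry_restrict_of_toLp hK hF hKF hμB).integral_prod_right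
  -- Pairing with an indicator commutes with the Bochner integral; Fubini then gives the integral
  -- over `B` of the pointwise one.
  · rw [← L2.inner_indicatorConstLp_one hB hμB.ne, ← integral_inner hK]
    simp_rw [L2.inner_indicatorConstLp_one hB hμB.ne]
    rw [← integral_integral_swap (integrable_uncurry_restrict_of_toLp hK hF hKF hμB)]
    exact integral_congr_ae (ae_of_all _ fun p => integral_congr_ae (ae_restrict_of_ae (hKF p)))

end FieldIntegral

/-! ### Joint measurability of integrals against the random measure -/

section KernelMeasurable

variable {S X V : Type*} [MeasurableSpace S] [MeasurableSpace X] [MeasurableSpace V]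

/-- Integrals over a set of finite random measure depend measurably on the sample and on a
parameter of the integrand. -/
theorem exists_stronglyMeasurable_setIntegral {N : S → Measure X} (hN : Measurable N) {J : Set X}
    (hJ : MeasurableSet J) {F : V → X → ℝ} (hF : StronglyMeasurable (Function.uncurry F)) :
    ∃ T : S × V → ℝ, StronglyMeasurable T ∧
      ∀ θ, N θ J ≠ ∞ → ∀ x, ∫ p in J, F x p ∂(N θ) = T (θ, x) := by
  have happ : ∀ C, MeasurableSet C → Measurable fun θ => N θ C := fun C hC =>
    (Measure.measurable_coe hC).comp hN
  -- Normalising by the mass gives a finite kernel even where `N θ J` is infinite (there `κ θ = 0`).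
  -- If the mass is `0`, the restricted measure is `0` and so is `κ θ`.
  let κ : Kernel S X := ⟨fun θ => (N θ J)⁻¹ • (N θ).restrict J, by
    refine Measure.measurable_of_measurable_coe _ fun C hC => ?_
    simp only [Measure.smul_apply, smul_eq_mul, Measure.restrict_apply hC]
    exact (happ J hJ).inv.mul (happ _ (hC.inter hJ))⟩
  have hκ : ∀ θ, κ θ = (N θ J)⁻¹ • (N θ).restrict J := fun θ => rfl
  have : IsFiniteKernel κ := ⟨1, ENNReal.one_lt_top, fun θ => by
    rw [hκ, Measure.smul_apply, Measure.restrict_apply_univ, smul_eq_mul]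
    exact ENNReal.inv_mul_le_one _⟩
  refine ⟨fun z => (N z.1 J).toReal * ∫ p, F z.2 p ∂(Kernel.prodMkRight V κ z), ?_, ?_⟩
  · refine StronglyMeasurable.mul ?_ (StronglyMeasurable.integral_kernel_prod_right
      (f := fun z : S × V => F z.2) ?_)
    · exact ((happ J hJ).comp measurable_fst).ennreal_toReal.stronglyMeasurable
    · exact hF.comp_measurable (f := Function.uncurry F)
        (g := fun q : (S × V) × X => (q.1.2, q.2)) (by fun_prop)
  · intro θ hθ x
    simp only [Kernel.prodMkRight_apply, hκ, integral_smul_measure, ENNReal.toReal_inv, smul_eq_mul]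
    by_cases h0 : N θ J = 0
    · rw [Measure.restrict_eq_zero.2 h0]; simp
    · rw [mul_inv_cancel_left₀ (ENNReal.toReal_ne_zero.2 ⟨h0, hθ⟩)]

end KernelMeasurable

/-! ### The Hilbert-valued integrals as functions of `x` -/

section Field

variable {d : ℕ} {s : ℝ} {G : EuclideanSpace ℝ (Fin d) → ℝ} {h : ℝ → ℝ}
  {k : Param d → Lp (α := EuclideanSpace ℝ (Fin d)) ℂ 2 volume}

/-- A continuous linear map commutes with the Bochner integral, whose value in `L²` is then computed
pointwise. -/
theorem sobolevEmb_integral_kernel (hs : 0 ≤ s) (hGm : Measurable G)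
    (hk : ∀ ω, sobolevEmb hs (k ω) =ᵐ[volume] fun x => (kernel G x ω : ℂ))
    {m : Measure (ℝ × Param d)} [SFinite m] {a : ℝ → ℝ} (ha : Measurable a)
    (hint : Integrable (fun p : ℝ × Param d => a p.1 • k p.2) m) :
    sobolevEmb hs (∫ p, a p.1 • k p.2 ∂m) =ᵐ[volume]
      fun x => ((∫ p, kernel G x p.2 * a p.1 ∂m : ℝ) : ℂ) := by
  rw [← ContinuousLinearMap.integral_comp_comm _ hint]
  have hF : StronglyMeasurable (Function.uncurry fun (p : ℝ × Param d)
      (x : EuclideanSpace ℝ (Fin d)) => ((kernel G x p.2 * a p.1 : ℝ) : ℂ)) := by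
    have h1 := (measurable_kernel hGm).comp (f := fun q : (ℝ × Param d) × EuclideanSpace ℝ (Fin d) =>
      (q.2, q.1.2)) (by fun_prop)
    exact (Complex.measurable_ofReal.comp (h1.mul (ha.comp (by fun_prop)))).stronglyMeasurable
  refine (coeFn_integral_ae_eq ((sobolevEmb hs).integrable_comp hint) hF fun p => ?_).trans
    (ae_of_all _ fun x => integral_ofReal)
  have h1 : sobolevEmb hs (a p.1 • k p.2) = (a p.1 : ℂ) • sobolevEmb hs (k p.2) := by
    rw [← map_smul]; rfl
  rw [h1]
  filter_upwards [Lp.coeFn_smul (a p.1 : ℂ) (sobolevEmb hs (k p.2)), hk p.2] with x hx hx'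
  rw [hx, Pi.smul_apply, hx', smul_eq_mul, Complex.ofReal_mul, mul_comm]

theorem truncField_ae_eq {S : Type*} (hs : 0 ≤ s) (hGm : Measurable G)
    (hk : ∀ ω, sobolevEmb hs (k ω) =ᵐ[volume] fun x => (kernel G x ω : ℂ)) (hh : Measurable h)
    {ν : Measure (ℝ × Param d)} [SFinite ν] {N : S → Measure (ℝ × Param d)} {θ : S} {ε : ℝ}
    [IsFiniteMeasure ((N θ).restrict (jumps d ε))]
    (h1 : IntegrableOn (fun p => p.1 • k p.2) (jumps d ε) (N θ))
    (h2 : IntegrableOn (fun p => h p.1 • k p.2) (jumps d ε) ν) :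
    (fun x => (truncField ν N h G ε θ x : ℂ)) =ᵐ[volume]
      sobolevEmb hs (truncInt ν Prod.fst h (fun p => k p.2) ε (N θ)) := by
  have e : truncInt ν Prod.fst h (fun p : ℝ × Param d => k p.2) ε (N θ) =
      (∫ p in jumps d ε, p.1 • k p.2 ∂(N θ)) - ∫ p in jumps d ε, h p.1 • k p.2 ∂ν := rfl
  rw [e, map_sub]
  filter_upwards [Lp.coeFn_sub (sobolevEmb hs (∫ p in jumps d ε, p.1 • k p.2 ∂(N θ)))
      (sobolevEmb hs (∫ p in jumps d ε, h p.1 • k p.2 ∂ν)),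
    sobolevEmb_integral_kernel hs hGm hk measurable_id h1,
    sobolevEmb_integral_kernel hs hGm hk hh h2] with x hx hx1 hx2
  simp only [id] at hx1
  rw [hx, Pi.sub_apply, hx1, hx2, truncField, Complex.ofReal_sub]

theorem lintegral_kernel_hilbert_ne_top {ν : Measure (ℝ × Param d)} {C : ℝ≥0∞} (hC : C ≠ ∞)
    (hkC : ∀ ω, ‖k ω‖ₑ ^ 2 ≤ ENNReal.ofReal (|ω.2.1.det|⁻¹ * (1 + rho ω.2.1 ^ (2 * s))) * C)
    (hν2 : ∫⁻ p, ENNReal.ofReal (|p.2.2.1.det|⁻¹ * (1 + rho p.2.2.1 ^ (2 * s)) *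
      min 1 (p.1 ^ 2)) ∂ν < ∞) :
    ∫⁻ p, ‖k p.2‖ₑ ^ 2 * ENNReal.ofReal (min 1 (p.1 ^ 2)) ∂ν ≠ ∞ := by
  refine ne_of_lt (lt_of_le_of_lt (lintegral_mono fun p => ?_)
    ((lintegral_const_mul' C (fun p : ℝ × Param d => ENNReal.ofReal (|p.2.2.1.det|⁻¹ *
      (1 + rho p.2.2.1 ^ (2 * s)) * min 1 (p.1 ^ 2))) hC).trans_lt
      (ENNReal.mul_lt_top hC.lt_top hν2)))
  have h0 : 0 ≤ |p.2.2.1.det|⁻¹ * (1 + rho p.2.2.1 ^ (2 * s)) := by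
    have : 0 ≤ rho p.2.2.1 := norm_nonneg _
    positivity
  rw [ENNReal.ofReal_mul h0, ← mul_assoc, mul_comm C]
  exact mul_le_mul_left (hkC p.2) _

/-- Tonelli: integrated over `x`, the quantity is at most `‖sobolevEmb‖²` times the integral of
`‖k‖² (1 ∧ β²)`. This is why the field is defined at almost every point. -/
theorem ae_lintegral_kernel_ne_top (hs : 0 ≤ s) (hGm : Measurable G)
    (hk : ∀ ω, sobolevEmb hs (k ω) =ᵐ[volume] fun x => (kernel G x ω : ℂ))
    {ν : Measure (ℝ × Param d)} [SFinite ν]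
    (hk2 : ∫⁻ p, ‖k p.2‖ₑ ^ 2 * ENNReal.ofReal (min 1 (p.1 ^ 2)) ∂ν ≠ ∞) :
    ∀ᵐ x : EuclideanSpace ℝ (Fin d),
      ∫⁻ p, ‖kernel G x p.2‖ₑ ^ 2 * ENNReal.ofReal (min 1 (p.1 ^ 2)) ∂ν ≠ ∞ := by
  have hm : Measurable fun z : EuclideanSpace ℝ (Fin d) × (ℝ × Param d) =>
      ‖kernel G z.1 z.2.2‖ₑ ^ 2 * ENNReal.ofReal (min 1 (z.2.1 ^ 2)) := by
    have h1 := (measurable_kernel hGm).comp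
      (f := fun q : EuclideanSpace ℝ (Fin d) × (ℝ × Param d) => (q.1, q.2.2)) (by fun_prop)
    exact (h1.enorm.pow_const 2).mul (by fun_prop)
  have key : ∫⁻ x, ∫⁻ p, ‖kernel G x p.2‖ₑ ^ 2 * ENNReal.ofReal (min 1 (p.1 ^ 2)) ∂ν ≠ ∞ := by
    rw [lintegral_lintegral_swap hm.aemeasurable]
    set c := ‖sobolevEmb (d := d) hs‖ₑ ^ 2
    have hc : c ≠ ∞ := ENNReal.pow_ne_top enorm_ne_top
    refine ne_of_lt (lt_of_le_of_lt (lintegral_mono fun p => ?_)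
      ((lintegral_const_mul' c (fun p : ℝ × Param d => ‖k p.2‖ₑ ^ 2 *
        ENNReal.ofReal (min 1 (p.1 ^ 2))) hc).trans_lt
        (ENNReal.mul_lt_top hc.lt_top hk2.lt_top)))
    rw [lintegral_mul_const' _ _ ENNReal.ofReal_ne_top, ← mul_assoc, ← mul_pow]
    refine mul_le_mul_left ?_ _
    have h1 : ∫⁻ x, ‖kernel G x p.2‖ₑ ^ 2 = ‖sobolevEmb hs (k p.2)‖ₑ ^ 2 := by
      rw [Lp.enorm_def, eLpNorm_two_eq_lintegral, ← ENNReal.rpow_natCast, ← ENNReal.rpow_mul]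
      norm_num
      refine lintegral_congr_ae ?_
      filter_upwards [hk p.2] with x hx
      rw [hx]
      simp [enorm_eq_nnnorm]
    rw [h1]
    exact pow_le_pow_left₀ zero_le ((sobolevEmb hs).le_opENorm _) 2
  filter_upwards [ae_lt_top (hm.lintegral_prod_right' (ν := ν)) key] with x hx using hx.ne

end Field


/-! ### Existence of the field and pointwise convergence -/

section MainField

variable {d : ℕ} {s : ℝ} {G : EuclideanSpace ℝ (Fin d) → ℝ} {h : ℝ → ℝ}
  {ν : Measure (ℝ × Param d)} {S : Type*} [MeasurableSpace S] {P : Measure S}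
  [IsProbabilityMeasure P] {N : S → Measure (ℝ × Param d)}

theorem tendsto_one_div_add_one_nhdsGT :
    Tendsto (fun n : ℕ => 1 / ((n : ℝ) + 1)) atTop (𝓝[>] 0) :=
  tendsto_nhdsWithin_iff.2 ⟨tendsto_one_div_add_atTop_nhds_zero_nat,
    Eventually.of_forall fun n => Set.mem_Ioi.2 (by positivity)⟩

/-- At a fixed point the truncated fields converge almost surely to the field. -/
theorem exists_isCompensatedIntegral_tendsto_truncField (hN : IsPoissonRandomMeasure P ν N)
    (hh : IsCompensator h) (hGm : Measurable G)
    (hν0 : ν {p | p.1 = 0} = 0) (hν1 : ∫⁻ p, ENNReal.ofReal (min 1 (p.1 ^ 2)) ∂ν ≠ ∞)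
    {x : EuclideanSpace ℝ (Fin d)}
    (hx : ∫⁻ p, ‖kernel G x p.2‖ₑ ^ 2 * ENNReal.ofReal (min 1 (p.1 ^ 2)) ∂ν ≠ ∞) :
    ∃ Z : S → ℝ, IsCompensatedIntegral P ν N (fun p => kernel G x p.2 * h p.1) Z ∧
      ∀ᵐ θ ∂P, Integrable (fun p => kernel G x p.2 * (p.1 - h p.1)) (N θ) ∧
        Tendsto (fun n : ℕ => truncField ν N h G (1 / ((n : ℝ) + 1)) θ x) atTop
          (𝓝 ((∫ p, kernel G x p.2 * (p.1 - h p.1) ∂(N θ)) + Z θ)) := by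
  have hkm : StronglyMeasurable fun p : ℝ × Param d => kernel G x p.2 :=
    ((measurable_kernel hGm).comp (f := fun q : ℝ × Param d => (x, q.2))
      (by fun_prop)).stronglyMeasurable
  -- The Hilbert space is now `ℝ` and the integrand `φ(x, ·)`.
  have hT := hN.ae_exists_tendsto_truncInt measurable_fst hh hν0 hν1 hkm hx
  have hI := hN.ae_integrable_sub_compensator_smul measurable_fst hh hν0 hν1 hkm hx
  have hL := memLp_two_compensator_smul measurable_fst hh hkm hx
  have hm : StronglyMeasurable fun p : ℝ × Param d => kernel G x p.2 * h p.1 :=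
    hkm.mul (hh.measurable.comp measurable_fst).stronglyMeasurable
  simp only [truncInt, smul_eq_mul] at hT hI hL
  simp_rw [mul_comm _ (kernel G x _)] at hT hI hL
  refine ⟨fun θ => limUnder atTop fun n : ℕ => compInt ν (N θ) (fun p => kernel G x p.2 * h p.1)
    (bigJumps Prod.fst (1 / ((n : ℝ) + 1))),
    hN.isCompensatedIntegral_of_tendsto measurable_fst hν0 hν1 hm hL ?_, ?_⟩
  · filter_upwards [hT] with θ hθ
    obtain ⟨z, hz, -⟩ := hθ
    exact tendsto_nhds_limUnder ⟨z, hz.comp tendsto_one_div_add_one_nhdsGT⟩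
  · filter_upwards [hT, hI] with θ hθ hθI
    obtain ⟨z, hz, hz'⟩ := hθ
    refine ⟨hθI, ?_⟩
    have h1 := (hz.comp tendsto_one_div_add_one_nhdsGT).limUnder_eq
    simp only [Function.comp_def] at h1
    rw [h1]
    exact hz'.comp tendsto_one_div_add_one_nhdsGT

theorem IsPoissonRandomMeasure.ae_forall_jumps_lt_top (hN : IsPoissonRandomMeasure P ν N)
    (hν0 : ν {p | p.1 = 0} = 0) (hν1 : ∫⁻ p, ENNReal.ofReal (min 1 (p.1 ^ 2)) ∂ν ≠ ∞) :
    ∀ᵐ θ ∂P, ∀ ε, 0 < ε → N θ (jumps d ε) < ∞ := by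
  filter_upwards [hN.ae_forall_integrableOn_bigJumps measurable_fst hν0 hν1
    (g := fun _ => (1 : ℝ)) stronglyMeasurable_const] with θ hθ ε hε
  exact ((integrableOn_const_iff (by simp)).1 (hθ ε hε)).resolve_left (by simp)

/-- The truncated fields at the levels `1 / (n + 1)` have jointly measurable versions. -/
theorem exists_stronglyMeasurable_truncField (hN : IsPoissonRandomMeasure P ν N)
    (hh : IsCompensator h) (hGm : Measurable G)
    (hν0 : ν {p | p.1 = 0} = 0) (hν1 : ∫⁻ p, ENNReal.ofReal (min 1 (p.1 ^ 2)) ∂ν ≠ ∞) :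
    ∃ D : ℕ → S × EuclideanSpace ℝ (Fin d) → ℝ, (∀ n, StronglyMeasurable (D n)) ∧
      ∀ᵐ θ ∂P, ∀ (n : ℕ) x, truncField ν N h G (1 / ((n : ℝ) + 1)) θ x = D n (θ, x) := by
  have hker : Measurable fun q : EuclideanSpace ℝ (Fin d) × (ℝ × Param d) =>
      kernel G q.1 q.2.2 :=
    (measurable_kernel hGm).comp (f := fun q : EuclideanSpace ℝ (Fin d) × (ℝ × Param d) =>
      (q.1, q.2.2)) (by fun_prop)
  have := sigmaFinite_of_bigJumps measurable_fst hν0 hν1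
  have hJ : ∀ ε, MeasurableSet (jumps d ε) := measurableSet_bigJumps measurable_fst
  choose T hTm hT using fun n : ℕ => exists_stronglyMeasurable_setIntegral hN.measurable
    (hJ (1 / ((n : ℝ) + 1))) (F := fun x p => kernel G x p.2 * p.1)
    (hker.mul (by fun_prop)).stronglyMeasurable
  refine ⟨fun n z => T n z - ∫ p in jumps d (1 / ((n : ℝ) + 1)), kernel G z.2 p.2 * h p.1 ∂ν,
    fun n => (hTm n).sub ?_, ?_⟩
  · have h1 : StronglyMeasurable (Function.uncurry
        fun (x : EuclideanSpace ℝ (Fin d)) (p : ℝ × Param d) => kernel G x p.2 * h p.1) :=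
      (hker.mul (hh.measurable.comp (by fun_prop))).stronglyMeasurable
    exact h1.integral_prod_right.comp_measurable measurable_snd
  · filter_upwards [hN.ae_forall_jumps_lt_top hν0 hν1] with θ hθ n x
    rw [truncField, hT n θ (hθ _ (by positivity)).ne x]

/-- The version is the pointwise limit of jointly measurable truncated fields; `limUnder` stays
jointly measurable, its value where there is no limit being irrelevant. -/
theorem exists_isLevyField (hN : IsPoissonRandomMeasure P ν N)
    (hh : IsCompensator h) (hGm : Measurable G)
    (hν0 : ν {p | p.1 = 0} = 0) (hν1 : ∫⁻ p, ENNReal.ofReal (min 1 (p.1 ^ 2)) ∂ν ≠ ∞)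
    (hx : ∀ᵐ x : EuclideanSpace ℝ (Fin d),
      ∫⁻ p, ‖kernel G x p.2‖ₑ ^ 2 * ENNReal.ofReal (min 1 (p.1 ^ 2)) ∂ν ≠ ∞) :
    ∃ f : S → EuclideanSpace ℝ (Fin d) → ℝ, IsLevyField P ν N h G f := by
  obtain ⟨D, hDm, hD⟩ := exists_stronglyMeasurable_truncField hN hh hGm hν0 hν1
  refine ⟨fun θ x => limUnder atTop fun n => D n (θ, x),
    (StronglyMeasurable.limUnder (l := atTop) hDm).measurable, ?_⟩
  filter_upwards [hx] with x hx
  obtain ⟨Z, hZ, hZ'⟩ :=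
    exists_isCompensatedIntegral_tendsto_truncField hN hh hGm hν0 hν1 hx
  refine ⟨Z, hZ, ?_⟩
  filter_upwards [hZ', hD] with θ hθ hθD
  refine ⟨hθ.1, Tendsto.limUnder_eq ?_⟩
  simpa only [hθD] using hθ.2

/-- Almost surely, the truncated fields converge to the field at almost every point. -/
theorem IsLevyField.ae_ae_tendsto (hN : IsPoissonRandomMeasure P ν N)
    (hh : IsCompensator h) (hGm : Measurable G)
    (hν0 : ν {p | p.1 = 0} = 0) (hν1 : ∫⁻ p, ENNReal.ofReal (min 1 (p.1 ^ 2)) ∂ν ≠ ∞)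
    (hx : ∀ᵐ x : EuclideanSpace ℝ (Fin d),
      ∫⁻ p, ‖kernel G x p.2‖ₑ ^ 2 * ENNReal.ofReal (min 1 (p.1 ^ 2)) ∂ν ≠ ∞)
    {f : S → EuclideanSpace ℝ (Fin d) → ℝ} (hf : IsLevyField P ν N h G f) :
    ∀ᵐ θ ∂P, ∀ᵐ x, Tendsto (fun n : ℕ => truncField ν N h G (1 / ((n : ℝ) + 1)) θ x) atTop
      (𝓝 (f θ x)) := by
  have := sigmaFinite_of_bigJumps measurable_fst hν0 hν1
  obtain ⟨D, hDm, hD⟩ := exists_stronglyMeasurable_truncField hN hh hGm hν0 hν1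
  -- The joint measurability of `f` enters here: Fubini can exchange "almost every `θ`" and "almost
  -- every `x`" only for a measurable set.
  have hset : MeasurableSet {z : S × EuclideanSpace ℝ (Fin d) |
      Tendsto (fun n => D n (z.1, z.2)) atTop (𝓝 (f z.1 z.2))} :=
    measurableSet_tendsto_fun (fun n => (hDm n).measurable) hf.measurable
  have key : ∀ᵐ θ ∂P, ∀ᵐ x, Tendsto (fun n => D n (θ, x)) atTop (𝓝 (f θ x)) := by
    rw [Measure.ae_ae_comm hset]
    filter_upwards [hx, hf.eq_integral] with x hx hfx
    obtain ⟨Z, hZ, hZ'⟩ :=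
      exists_isCompensatedIntegral_tendsto_truncField hN hh hGm hν0 hν1 hx
    obtain ⟨Z₁, hZ₁, hZ₁'⟩ := hfx
    -- The given version of the field may use another compensated integral `Z₁`; uniqueness
    -- identifies it with `Z` almost surely.
    filter_upwards [hZ', hZ₁', hD, hN.ae_eq_of_isCompensatedIntegral hZ hZ₁] with θ h1 h2 h3 h4
    rw [h2.2, ← h4]
    simpa only [h3] using h1.2
  filter_upwards [key, hD] with θ h1 h2
  simpa only [h2] using h1

end MainField

end LevyField

/-! ### The main theorem -/

theorem theorem6 {d : ℕ} (hd : 1 ≤ d) {s : ℝ} (hs : 0 ≤ s)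
    (G : EuclideanSpace ℝ (Fin d) → ℝ) (hGm : Measurable G) (hG : LevyField.MemW s G)
    (ν : Measure (ℝ × LevyField.Param d))
    (hν0 : ν {p | p.1 = 0} = 0)
    (hν1 : ∫⁻ p, ENNReal.ofReal (min 1 (p.1 ^ 2)) ∂ν < ∞)
    (hν2 : ∫⁻ p, ENNReal.ofReal (|p.2.2.1.det|⁻¹ *
      (1 + LevyField.rho p.2.2.1 ^ (2 * s)) * min 1 (p.1 ^ 2)) ∂ν < ∞)
    (h : ℝ → ℝ) (hh : LevyField.IsCompensator h)
    {S : Type*} [MeasurableSpace S] (P : Measure S) [IsProbabilityMeasure P]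
    (N : S → Measure (ℝ × LevyField.Param d))
    (hN : LevyField.IsPoissonRandomMeasure P ν N) :
    (∃ f : S → EuclideanSpace ℝ (Fin d) → ℝ, LevyField.IsLevyField P ν N h G f) ∧
    ∀ f : S → EuclideanSpace ℝ (Fin d) → ℝ, LevyField.IsLevyField P ν N h G f →
      ∀ᵐ θ ∂P,
        (∀ ε : ℝ, 0 < ε → LevyField.MemW s (LevyField.truncField ν N h G ε θ)) ∧
        LevyField.MemW s (f θ) ∧
        Tendsto (fun ε : ℝ => LevyField.sobolevNorm s
          (fun x => LevyField.truncField ν N h G ε θ x - f θ x)) (𝓝[>] 0) (𝓝 0) := by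
  obtain ⟨k, hkm, hk, C, hC, hkC⟩ := LevyField.exists_kernel_hilbert hs hG
  have hν1' := hν1.ne
  have hb : Measurable (Prod.fst : ℝ × LevyField.Param d → ℝ) := measurable_fst
  have := LevyField.sigmaFinite_of_bigJumps hb hν0 hν1'
  have hk2 := LevyField.lintegral_kernel_hilbert_ne_top hC hkC hν2
  have hx := LevyField.ae_lintegral_kernel_ne_top hs hGm hk hk2
  have hkm' : StronglyMeasurable fun p : ℝ × LevyField.Param d => k p.2 := hkm.comp_measurable measurable_snd
  refine ⟨LevyField.exists_isLevyField hN hh hGm hν0 hν1' hx, fun f hf => ?_⟩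
  filter_upwards [hf.ae_ae_tendsto hN hh hGm hν0 hν1' hx,
    hN.ae_exists_tendsto_truncInt hb hh hν0 hν1' hkm' hk2,
    hN.ae_forall_jumps_lt_top hν0 hν1',
    hN.ae_forall_integrableOn_bigJumps hb hν0 hν1' (hb.stronglyMeasurable.smul hkm')]
    with θ hlim hconv hfin hbk
  obtain ⟨z, -, hz⟩ := hconv
  set u := (∫ p, (p.1 - h p.1) • k p.2 ∂(N θ)) + z
  have htr : ∀ ε, 0 < ε → (fun x => (LevyField.truncField ν N h G ε θ x : ℂ)) =ᵐ[volume]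
      LevyField.sobolevEmb hs (LevyField.truncInt ν Prod.fst h (fun p => k p.2) ε (N θ)) := fun ε hε => by
    have : IsFiniteMeasure ((N θ).restrict (LevyField.jumps d ε)) := ⟨by simpa using hfin ε hε⟩
    exact LevyField.truncField_ae_eq hs hGm hk hh.measurable (hbk ε hε)
      (LevyField.integrableOn_bigJumps_of_memLp_two hb hν1' (LevyField.memLp_two_compensator_smul hb hh hkm' hk2) hε)
  -- Along the levels `1 / (n + 1)` the truncated fields tend to `sobolevEmb hs u` in `L²`, hence
  -- almost everywhere on a subsequence, and to `f θ` almost everywhere.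
  have hfu : (fun x => (f θ x : ℂ)) =ᵐ[volume] LevyField.sobolevEmb hs u := by
    have h1 := ((LevyField.sobolevEmb hs).continuous.tendsto u).comp
      (hz.comp LevyField.tendsto_one_div_add_one_nhdsGT)
    obtain ⟨n, hn, hn'⟩ := (tendstoInMeasure_of_tendsto_Lp h1).exists_seq_tendsto_ae
    filter_upwards [hlim, hn', ae_all_iff.2 fun i : ℕ => htr (1 / ((i : ℝ) + 1)) (by positivity)]
      with x hx1 hx2 hx3
    refine tendsto_nhds_unique ?_ hx2
    have h2 := ((Complex.continuous_ofReal.tendsto _).comp hx1).comp hn.tendsto_atTop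
    refine h2.congr fun i => ?_
    exact hx3 (n i)
  refine ⟨fun ε hε => ?_, ?_, ?_⟩
  · rw [LevyField.MemW, LevyField.sobolevNorm_eq_of_ae hs (htr ε hε)]; exact enorm_lt_top
  · rw [LevyField.MemW, LevyField.sobolevNorm_eq_of_ae hs hfu]; exact enorm_lt_top
  · have h1 : Tendsto (fun ε => ‖LevyField.truncInt ν Prod.fst h (fun p => k p.2) ε (N θ) - u‖ₑ)
        (𝓝[>] 0) (𝓝 0) := by
      have := (continuous_enorm.tendsto _).comp (hz.sub_const u)
      simpa [Function.comp_def] using this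
    refine h1.congr' ?_
    filter_upwards [self_mem_nhdsWithin] with ε hε
    refine (LevyField.sobolevNorm_eq_of_ae hs ?_).symm
    rw [map_sub]
    filter_upwards [htr ε hε, hfu, Lp.coeFn_sub (LevyField.sobolevEmb hs
      (LevyField.truncInt ν Prod.fst h (fun p => k p.2) ε (N θ))) (LevyField.sobolevEmb hs u)] with x h1 h2 h3
    rw [h3, Pi.sub_apply, ← h1, ← h2, Complex.ofReal_sub]
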